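/- **The tile.** The monotile is a closed regular hexagon of inradius $1/2$ whose edges $0,1,\dots,5$ are numbered counterclockwise, edge $i$ having outward normal at angle $i\pi/3$. It carries three disjoint R1-curves: a straight one joining edges $0$ and $3$, and two small ones (the R1-corners, of angle $\pi/3$) joining edges $1,2$ and edges $4,5$. Each edge is met by exactly one R1-curve, off-centre by a fixed distance, on the counterclockwise side of the midpoint for the edges $0,1,4$ and on the clockwise side for the edges $2,3,5$. It also carries a connected R2-tree which ends at the midpoints of the edges $0,2,3,5$. **Legal tilings.** A tiling $T$ is a covering of the plane $\mathbb{C}$ by images of the monotile under direct isometries, with pairwise disjoint interiors. It satisfies R1 if at every edge of every tile the R1-curve continues into the R1-curve of the adjacent tile sharing this edge. It satisfies R2 if the union of the R2-trees is connected: any two tiles are linked by a finite chain of tiles in which consecutive tiles share an edge at whose midpoint both their trees end. A bi-infinite R1-line is a bi-infinite R1-curve made of straight R1-curves only; an R1-triangle of length $L$ is a closed R1-curve with three corners, joined by three sides made of the straight R1-curves of $L$ tiles each; an infinite R1-triangle consists of two infinite straight R1-rays joined by an R1-corner. $\mathcal{C}_1$ is the class of tilings that satisfy R1 and R2 and contain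 a bi-infinite R1-line. Call $h:\mathbb{Z}\to\mathbb{N}=\{0,1,2,\dots\}$ *interlaced* if for every $m\in\mathbb{N}$ the set $\{n : h(n)=m\}$ is exactly one residue class modulo $2^{m+1}$. **Proposition.** 1. $\mathcal{C}_1$ is non-empty. 2. Every tiling in $\mathcal{C}_1$ is nonperiodic, i.e. no non-zero translation maps it onto itself. 3. No tiling in $\mathcal{C}_1$ contains an infinite R1-triangle. 4. Let $T\in\mathcal{C}_1$ contain the bi-infinite R1-line through the consecutive tiles $(t_n)_{n\in\mathbb{Z}}$. Then there are interlaced functions $h_1,h_2$ such that for every $n$ the small R1-curve of $t_n$ on edges $1,2$ (one side of the line) is a corner of an R1-triangle of length $2^{h_1(n)}-1$, and the one on edges $4,5$ (the other side of the line) is a corner of an R1-triangle of length $2^{h_2(n)}-1$. 5. Conversely, for every placement $p$ of the monotile in the plane and all interlaced $h_1,h_2$ there is exactly one $T\in\mathcal{C}_1$ with a bi-infinite R1-line $(t_n)_{n\in\mathbb{Z}}$ such that $t_0=p$, $t_1$ is the tile across edge $0$ of $t_0$, and $T$ has the R1-triangles described in 4 for $h_1$ and $h_2$. -/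

import Mathlib

namespace DendriteMonotile

noncomputable section

/-! The prototile is the closed regular hexagon in `ℂ` with centre `0` and inradius `1/2`. Its edges
are numbered counterclockwise by `Fin 6`; edge `i` has outward unit normal `dir i`, at angle
`i * π / 3`. -/

/-- The unit vector at angle `i * π / 3`. -/
def dir (i : Fin 6) : ℂ := Complex.exp (((i : ℕ) : ℂ) * (Real.pi / 3 : ℝ) * Complex.I)

/-- The closed regular hexagon underlying the prototile. -/
def hexagon : Set ℂ := {z | ∀ i : Fin 6, (z * (starRingEnd ℂ) (dir i)).re ≤ 1 / 2}

/-! Decorations of the prototile. Three disjoint R1-curves: a straight one joining edges `0` and `3`,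
and two small ones (corners of angle `π/3`) joining edges `1` and `2`, and edges `4` and `5`. Each
edge is met by exactly one R1-curve, off-centre, on the side recorded by `offset`. The R2-tree is a
connected tree ending at the midpoints of the four edges in `treeEnds`. -/

/-- The other end of the R1-curve that meets edge `i`. -/
def mate : Fin 6 → Fin 6 := ![3, 2, 1, 0, 5, 4]

/-- The side of the midpoint of edge `i` on which the R1-curve meets it: `1` is the
counterclockwise side, `-1` the clockwise side. -/
def offset : Fin 6 → ℝ := ![1, 1, -1, -1, 1, -1]

/-- The edges met by the straight R1-curve. -/
def IsStraight (i : Fin 6) : Prop := i = 0 ∨ i = 3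

/-- The edges met (in their midpoints) by the R2-tree. -/
def treeEnds : Finset (Fin 6) := {0, 2, 3, 5}

/-- A placed copy of the monotile: the image of the decorated prototile under the direct isometry
`z ↦ rot * z + center`. The decorated prototile has no symmetry, so that the copies correspond
to the direct isometries. -/
@[ext]
structure Tile where
  rot : Circle
  center : ℂ

namespace Tile

/-- The direct isometry that places the tile. -/
def place (p : Tile) (z : ℂ) : ℂ := (p.rot : ℂ) * z + p.center

/-- The closed hexagon covered by the tile. -/
def support (p : Tile) : Set ℂ := p.place '' hexagon

/-- The outward unit normal of edge `i`. -/
def normal (p : Tile) (i : Fin 6) : ℂ := (p.rot : ℂ) * dir i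

/-- The midpoint of edge `i`. -/
def edgeMid (p : Tile) (i : Fin 6) : ℂ := p.place (dir i / 2)

/-- The point where an R1-curve meets edge `i`, at distance `1/8` from the midpoint (the half-length
of the edge is `√3/6`). -/
def r1End (p : Tile) (i : Fin 6) : ℂ :=
  p.place (dir i * (1 / 2 + (offset i / 8 : ℝ) * Complex.I))

/-- The tile translated by `v`. -/
def translate (v : ℂ) (p : Tile) : Tile := ⟨p.rot, p.center + v⟩

end Tile

/-- Edge `i` of `p` is edge `j` of `q`, with the two tiles on opposite sides of it. -/
def SharesEdge (p : Tile) (i : Fin 6) (q : Tile) (j : Fin 6) : Prop :=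
  p.edgeMid i = q.edgeMid j ∧ p.normal i = -q.normal j

/-- The R1-curve of `p` at edge `i` continues across that edge into the R1-curve of the adjacent
tile `q` at its edge `j`. -/
def R1Joined (p : Tile) (i : Fin 6) (q : Tile) (j : Fin 6) : Prop :=
  SharesEdge p i q j ∧ p.r1End i = q.r1End j

/-- The R2-trees of the adjacent tiles `p` and `q` meet (in the midpoint of a common edge). -/
def TreesMeet (p q : Tile) : Prop :=
  ∃ i ∈ treeEnds, ∃ j ∈ treeEnds, SharesEdge p i q j

/-- A tiling of the plane by direct isometries of the monotile: the tiles cover the plane and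
distinct tiles have disjoint interiors. -/
structure IsTiling (T : Set Tile) : Prop where
  cover : ⋃ p ∈ T, p.support = Set.univ
  disjoint : ∀ p ∈ T, ∀ q ∈ T, p ≠ q → Disjoint (interior p.support) (interior q.support)

/-- Rule R1: the R1-curves are continuous across tiles, i.e. at every edge of every tile the
R1-curve continues into the adjacent tile. -/
def SatisfiesR1 (T : Set Tile) : Prop :=
  ∀ p ∈ T, ∀ i, ∃ q ∈ T, ∃ j, R1Joined p i q j

/-- Rule R2: the union of the R2-trees is connected, i.e. any two tiles are linked by a finite chain
of tiles in which the trees of consecutive tiles meet. -/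
def SatisfiesR2 (T : Set Tile) : Prop :=
  ∀ p ∈ T, ∀ q ∈ T, Relation.ReflTransGen (fun a b => a ∈ T ∧ b ∈ T ∧ TreesMeet a b) p q

/-- The class of legal tilings. -/
def classC : Set (Set Tile) := {T | IsTiling T ∧ SatisfiesR1 T ∧ SatisfiesR2 T}

/-- No non-zero translation maps the tiling onto itself. -/
def Nonperiodic (T : Set Tile) : Prop :=
  ∀ v : ℂ, Tile.translate v '' T = T → v = 0

/-- A bi-infinite walk along the R1-curves of `T`: the `n`-th step crosses the tile `(γ n).1` along
an R1-curve, from its end at edge `(γ n).2` to its other end. -/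
def IsR1Walk (T : Set Tile) (γ : ℤ → Tile × Fin 6) : Prop :=
  ∀ n, (γ n).1 ∈ T ∧ R1Joined (γ n).1 (mate (γ n).2) (γ (n + 1)).1 (γ (n + 1)).2

/-- A bi-infinite R1-line. -/
def IsR1Line (T : Set Tile) (γ : ℤ → Tile × Fin 6) : Prop :=
  IsR1Walk T γ ∧ ∀ n, IsStraight (γ n).2

/-- A (finite) R1-triangle of length `L`: a closed R1-curve with three sides, each side made of
the straight R1-curves of `L` tiles, successive sides being joined by a corner. -/
def IsR1Triangle (T : Set Tile) (L : ℕ) (γ : ℤ → Tile × Fin 6) : Prop :=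
  IsR1Walk T γ ∧ (∀ n, γ (n + 3 * (L + 1)) = γ n) ∧
    ∀ n, ¬ IsStraight (γ n).2 ↔ ((L : ℤ) + 1) ∣ n

/-- An infinite R1-triangle: two infinite R1-rays connected by one R1-corner. -/
def IsInfiniteR1Triangle (T : Set Tile) (γ : ℤ → Tile × Fin 6) : Prop :=
  IsR1Walk T γ ∧ ∀ n, ¬ IsStraight (γ n).2 ↔ n = 0

/-- The legal tilings that contain a bi-infinite R1-line. -/
def classC1 : Set (Set Tile) := {T | T ∈ classC ∧ ∃ γ, IsR1Line T γ}

/-- The small R1-curve of `p` at edge `e` is a corner of an R1-triangle of length `L`. -/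
def IsCornerOfTriangle (T : Set Tile) (p : Tile) (e : Fin 6) (L : ℕ) : Prop :=
  ∃ τ, IsR1Triangle T L τ ∧ τ 0 = (p, e)

/-- The levels `h n` form an interlaced periodic family: for each `m`, the positions of level `m`
are exactly one residue class modulo `2 ^ (m + 1)`. -/
def IsInterlaced (h : ℤ → ℕ) : Prop :=
  ∀ m : ℕ, ∃ l : ℤ, ∀ n : ℤ, h n = m ↔ ∃ k : ℤ, n = l + k * 2 ^ (m + 1)

/-- At the R1-line `γ`, on the side of the line where its tiles have the small R1-curve that meets
edge `e` (`e = 1` and `e = 4` are the two sides), the triangle with a corner on the `n`-th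
tile has length `2 ^ h n - 1`, for every `n`. -/
def HasLevels (T : Set Tile) (γ : ℤ → Tile × Fin 6) (e : Fin 6) (h : ℤ → ℕ) : Prop :=
  ∀ n, IsCornerOfTriangle T (γ n).1 e (2 ^ h n - 1)

end

end DendriteMonotile

open DendriteMonotile

/-!
A tiling that satisfies R1 is edge-to-edge, so its tiles occupy the sites `x + y * exp (i π / 3)` of a
triangular lattice (`exists_eq_latticeTiling`), and it amounts to an orientation `a (x, y) : Fin 6` of
each site. Modulo `π`, the direction of the straight R1-curve at a site is its *axis* in `Fin 3`. R1
says that in each row of direction `d` the sites whose axis is not `d` alternate between the two other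
axes (`axis_ne_of_run`), and the sides on which the straight R1-curves run follow from that.

*Structure.* Let the row `y = 0` be a bi-infinite line. Going up row by row, R1 forces the axis of
`(x, y)` from the rows below it, with a binary choice in the rows `y = 2 ^ j` only
(`exists_isLevelRow_add_one`). The outcome is that the axis of `(x, y)` compares the levels `h x` and
`h (x + y)` of the two positions of the line that lie below it in the directions `-2π/3` and `-π/3`,
for some interlaced `h` (`exists_isLevelRow`), unless some column above the line is straight to
infinity. The choice at height `2 ^ j` is the residue class of the positions of level `j`.

*Connectedness.* The R2-trees link a run of sites of axis `d` along the direction `d` to the one of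
its ends whose axis is `d + 1`, the parent of these sites. Parents are unique (`Parent.unique`), and the
sites of a bi-infinite line have none, so if the trees are connected then every site without a parent
is on that line (`snd_eq_zero_of_not_parent`). One of the rays of an infinite triangle would consist of
sites without parents, whence there are no infinite triangles (`not_infinite_ray`). Conversely, in a
half-plane with levels `h` the sequence of parents from any site reaches the line, because the levels
increase while the height remains bounded by a power of `2` (`linked_to_line`).

The levels can be prescribed on both sides of the line, where the lower half-plane is the upper one
after a rotation by `π` (`exists_legal_of_levels`, `latticeTiling_rotate`), they determine the tiling
(`legal_unique`), and they are the exponents of the lengths of the triangles along the line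
(`isCornerOfTriangle_of_isLevelRow`, `eq_of_isCornerOfTriangle`). A translation that preserves the
tiling preserves the line and is a period of `h`, hence zero (`nonperiodic_latticeTiling`).
-/

namespace DendriteMonotile

/-! ### Interlaced functions -/

namespace IsInterlaced

variable {h : ℤ → ℕ}

theorem eq_of_dvd (hh : IsInterlaced h) {x y : ℤ} (hd : (2 : ℤ) ^ (h x + 1) ∣ y - x) :
    h y = h x := by
  obtain ⟨l, hl⟩ := hh (h x)
  obtain ⟨k, hk⟩ := (hl x).1 rfl
  obtain ⟨c, hc⟩ := hd
  exact (hl y).2 ⟨k + c, by linear_combination hc + hk⟩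

theorem dvd_of_eq (hh : IsInterlaced h) {x y : ℤ} (he : h y = h x) :
    (2 : ℤ) ^ (h x + 1) ∣ y - x := by
  obtain ⟨l, hl⟩ := hh (h x)
  obtain ⟨k, hk⟩ := (hl x).1 rfl
  obtain ⟨c, hc⟩ := (hl y).1 he
  exact ⟨c - k, by linear_combination hc - hk⟩

theorem exists_eq (hh : IsInterlaced h) (m : ℕ) : ∃ n, h n = m := by
  obtain ⟨l, hl⟩ := hh m
  exact ⟨l, (hl l).2 ⟨0, by simp⟩⟩

/-- The positions of level at least `m` lie in one residue class modulo `2 ^ m`. -/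
theorem dvd_of_le (hh : IsInterlaced h) (m : ℕ) :
    ∀ {x y : ℤ}, m ≤ h x → m ≤ h y → (2 : ℤ) ^ m ∣ y - x := by
  induction m with
  | zero => simp
  | succ m ih =>
    intro x y hx hy
    obtain ⟨l, hl⟩ := hh.exists_eq m
    obtain ⟨c, hc⟩ := ih (x := x) (y := l) (by omega) (by omega)
    obtain ⟨d, hd⟩ := ih (x := y) (y := l) (by omega) (by omega)
    have key : ∀ {z e : ℤ}, m + 1 ≤ h z → l - z = 2 ^ m * e → ¬ Even e := by
      rintro z e hz he ⟨r, hr⟩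
      have : (2 : ℤ) ^ (h l + 1) ∣ z - l := ⟨-r, by rw [hl, pow_succ]; subst hr; linear_combination -he⟩
      have := hh.eq_of_dvd this
      omega
    have h1 := key hx hc
    have h2 := key hy hd
    rw [Int.not_even_iff_odd] at h1 h2
    obtain ⟨r, hr⟩ := h1.sub_odd h2
    exact ⟨r, by rw [pow_succ]; linear_combination hc - hd + 2 ^ m * hr⟩

theorem eq_iff (hh : IsInterlaced h) {x y : ℤ} :
    h x = h (x + y) ↔ (2 : ℤ) ^ (h x + 1) ∣ y := by
  constructor
  · intro e
    simpa using hh.dvd_of_eq e.symm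
  · intro e
    exact (hh.eq_of_dvd (by simpa using e)).symm

theorem le_iff (hh : IsInterlaced h) {x y : ℤ} :
    h x ≤ h (x + y) ↔ (2 : ℤ) ^ h x ∣ y := by
  constructor
  · intro e
    simpa using hh.dvd_of_le (h x) le_rfl e
  · intro e
    by_contra! hlt
    have h1 : (2 : ℤ) ^ (h (x + y) + 1) ∣ y := (pow_dvd_pow 2 hlt).trans e
    have : h x = h (x + y) := hh.eq_of_dvd (x := x + y) (y := x) (by
      have : x - (x + y) = -y := by ring
      rw [this]; exact (dvd_neg).2 h1)
    omega

theorem eq_iff' (hh : IsInterlaced h) {x y : ℤ} :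
    h x = h (x + y) ↔ (2 : ℤ) ^ (h (x + y) + 1) ∣ y := by
  have := hh.eq_iff (x := x + y) (y := -y)
  simp only [add_neg_cancel_right, dvd_neg] at this
  rw [← this, eq_comm]

theorem le_iff' (hh : IsInterlaced h) {x y : ℤ} :
    h (x + y) ≤ h x ↔ (2 : ℤ) ^ h (x + y) ∣ y := by
  have := hh.le_iff (x := x + y) (y := -y)
  simpa only [add_neg_cancel_right, dvd_neg] using this

theorem comp_add (hh : IsInterlaced h) (c : ℤ) : IsInterlaced fun n => h (n + c) := by
  intro m
  obtain ⟨l, hl⟩ := hh m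
  refine ⟨l - c, fun n => (hl _).trans ?_⟩
  exact exists_congr fun k => ⟨fun e => by linear_combination e, fun e => by linear_combination e⟩

theorem comp_neg (hh : IsInterlaced h) : IsInterlaced fun n => h (-n) := by
  intro m
  obtain ⟨l, hl⟩ := hh m
  refine ⟨-l, fun n => (hl _).trans ⟨?_, ?_⟩⟩
  · rintro ⟨k, e⟩
    exact ⟨-k, by linear_combination -e⟩
  · rintro ⟨k, e⟩
    exact ⟨-k, by linear_combination -e⟩

/-- An interlaced function has no non-zero period. -/
theorem eq_zero_of_periodic (hh : IsInterlaced h) {c : ℤ} (hc : ∀ n, h (n + c) = h n) : c = 0 := by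
  by_contra hne
  obtain ⟨n, hn⟩ := hh.exists_eq c.natAbs
  have h1 := hh.eq_iff.1 (hc n).symm
  rw [hn] at h1
  have h2 : (2 : ℤ) ^ (c.natAbs + 1) ≤ |c| := Int.le_of_dvd (abs_pos.2 hne) ((dvd_abs _ _).2 h1)
  have h3 : c.natAbs + 1 < 2 ^ (c.natAbs + 1) := Nat.lt_two_pow_self
  have h4 : ((c.natAbs : ℕ) : ℤ) = |c| := Int.natCast_natAbs c
  have h5 : ((c.natAbs + 1 : ℕ) : ℤ) < ((2 ^ (c.natAbs + 1) : ℕ) : ℤ) := by exact_mod_cast h3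
  push_cast at h5
  omega

end IsInterlaced

/-- The `2`-adic distance to `-1/3`, which is no integer, gives an interlaced function. -/
theorem exists_isInterlaced : ∃ h : ℤ → ℕ, IsInterlaced h := by
  refine ⟨fun n => padicValInt 2 (3 * n + 1), fun m => ?_⟩
  obtain ⟨l, c, hl⟩ : ∃ l c : ℤ, 3 * l + 1 = 2 ^ m * (2 * c + 1) := by
    rcases Nat.even_or_odd' m with ⟨k, rfl | rfl⟩
    · have : (3 : ℤ) ∣ 4 ^ k - 1 := by simpa using sub_dvd_pow_sub_pow (4 : ℤ) 1 k
      obtain ⟨r, hr⟩ := this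
      exact ⟨r, 0, by rw [pow_mul]; norm_num; linear_combination -hr⟩
    · have : (3 : ℤ) ∣ 4 ^ k - 1 := by simpa using sub_dvd_pow_sub_pow (4 : ℤ) 1 k
      obtain ⟨r, hr⟩ := this
      exact ⟨10 * r + 3, 2, by rw [pow_succ, pow_mul]; norm_num; linear_combination -10 * hr⟩
  refine ⟨l, fun n => ?_⟩
  have hne : 3 * n + 1 ≠ 0 := by omega
  have h1 : padicValInt 2 (3 * n + 1) = m ↔
      (2 : ℤ) ^ m ∣ 3 * n + 1 ∧ ¬ (2 : ℤ) ^ (m + 1) ∣ 3 * n + 1 := by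
    have a := padicValInt_dvd_iff (p := 2) m (3 * n + 1)
    have b := padicValInt_dvd_iff (p := 2) (m + 1) (3 * n + 1)
    simp only [hne, false_or, Nat.cast_ofNat] at a b
    rw [a, b]; omega
  have hp : (0 : ℤ) < 2 ^ m := by positivity
  rw [h1]
  constructor
  · rintro ⟨⟨e, he⟩, h2⟩
    have ho : ¬ Even e := by
      rintro ⟨r, hr⟩
      exact h2 ⟨r, by rw [he, hr]; ring⟩
    obtain ⟨r, hr⟩ := Int.not_even_iff_odd.1 ho
    have h3 : (2 : ℤ) ^ (m + 1) ∣ 3 * (n - l) := ⟨r - c, by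
      rw [pow_succ]; subst hr; linear_combination he - hl⟩
    have h4 : IsCoprime ((2 : ℤ) ^ (m + 1)) 3 := IsCoprime.pow_left (by norm_num)
    obtain ⟨k, hk⟩ := h4.dvd_of_dvd_mul_left h3
    exact ⟨k, by linear_combination hk⟩
  · rintro ⟨k, rfl⟩
    have h5 : 3 * (l + k * 2 ^ (m + 1)) + 1 = 2 ^ m * (2 * (c + 3 * k) + 1) := by
      rw [pow_succ]; linear_combination hl
    rw [h5]
    refine ⟨⟨_, rfl⟩, ?_⟩
    rintro ⟨r, hr⟩
    have : 2 * (c + 3 * k) + 1 = 2 * r := by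
      apply mul_left_cancel₀ hp.ne'
      rw [hr]; ring
    omega

/-! ### Rule R1 on the triangular lattice -/

/-- The side of the midpoint of edge `i` on which the R1-curve meets it, `true` being the
counterclockwise side. -/
def osign : Fin 6 → Bool := ![true, true, false, false, true, false]

/-- The direction modulo `π`, in units of `π / 3`, of the straight R1-curve of a tile rotated by
`i * π / 3`. -/
def axis : Fin 6 → Fin 3 := ![0, 1, 2, 0, 1, 2]

/-- The unit vectors of the triangular lattice, in the basis `1, exp (i π / 3)`. -/
def step : Fin 6 → ℤ × ℤ := ![(1, 0), (0, 1), (-1, 1), (-1, 0), (0, -1), (1, -1)]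

/-- Rule R1 for the tiling with a tile rotated by `a s * π / 3` at each lattice site `s`. -/
def Legal (a : ℤ × ℤ → Fin 6) : Prop :=
  ∀ s d, osign (d - a s) ≠ osign (d + 3 - a (s + step d))

theorem Legal.right {a : ℤ × ℤ → Fin 6} (ha : Legal a) (x y : ℤ) :
    osign (0 - a (x, y)) ≠ osign (3 - a (x + 1, y)) := by
  simpa [step] using ha (x, y) 0

theorem Legal.up {a : ℤ × ℤ → Fin 6} (ha : Legal a) (x y : ℤ) :
    osign (1 - a (x, y)) ≠ osign (4 - a (x, y + 1)) := by
  simpa [step] using ha (x, y) 1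

theorem Legal.upLeft {a : ℤ × ℤ → Fin 6} (ha : Legal a) (x y : ℤ) :
    osign (2 - a (x + 1, y)) ≠ osign (5 - a (x, y + 1)) := by
  simpa [step] using ha (x + 1, y) 2

theorem osign_opposite_of_axis_eq {d t : Fin 6} (h : axis t = axis d) :
    osign (d + 3 - t) = !osign (d - t) := by
  revert d t; decide

theorem osign_opposite_of_axis_ne {d t : Fin 6} (h : axis t ≠ axis d) :
    osign (d + 3 - t) = osign (d - t) := by
  revert d t; decide

theorem osign_ne_of_axis_ne {d s t : Fin 6} (hs : axis s ≠ axis d) (ht : axis t ≠ axis d)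
    (h : osign (d - s) ≠ osign (d - t)) : axis s ≠ axis t := by
  revert d s t; decide

/-- Along a line of direction `d`, the sites whose axis is not `d` alternate between the two other
axes: an R1-segment bends to the same side at both of its ends. -/
theorem axis_ne_of_run {b : ℕ → Fin 6} {d : Fin 6}
    (hb : ∀ i, osign (d - b i) ≠ osign (d + 3 - b (i + 1))) {N : ℕ} (hN : 0 < N)
    (h0 : axis (b 0) ≠ axis d) (hrun : ∀ i, 0 < i → i < N → axis (b i) = axis d)
    (hlast : axis (b N) ≠ axis d) : axis (b 0) ≠ axis (b N) := by
  have key : ∀ i, i < N → osign (d - b i) = osign (d - b 0) := by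
    intro i
    induction i with
    | zero => simp
    | succ i ih =>
      intro hi
      have h1 := hb i
      rw [osign_opposite_of_axis_eq (hrun (i + 1) (by omega) hi), ih (by omega)] at h1
      revert h1
      cases osign (d - b 0) <;> cases osign (d - b (i + 1)) <;> simp
  obtain ⟨M, rfl⟩ : ∃ M, N = M + 1 := ⟨N - 1, by omega⟩
  apply osign_ne_of_axis_ne h0 hlast
  have h1 := hb M
  rwa [key M (by omega), osign_opposite_of_axis_ne hlast] at h1

/-! ### The half-plane above a bi-infinite line -/

/-- The axis of the site `(x, y)` of the upper half-plane, when `i` and `j` are the levels of the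
positions `x` and `x + y` below it, in the directions `-2π/3` and `-π/3`, on the line `y = 0`. -/
def levelAxis (i j : ℕ) : Fin 3 := if i = j then 0 else if j < i then 1 else 2

/-- Row `y` of `a` is the row prescribed by the levels `h`. The last two conditions give the
sides on which the R1-curves leave `(x, y)` upwards: they change where a column with foot of level `k`
passes a height divisible by `2 ^ k`. -/
def IsLevelRow (a : ℤ × ℤ → Fin 6) (h : ℤ → ℕ) (y : ℤ) : Prop :=
  ∀ x, axis (a (x, y)) = levelAxis (h x) (h (x + y)) ∧
    (osign (1 - a (x, y)) = true ↔ Even (y / 2 ^ h x)) ∧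
    (osign (2 - a (x, y)) = true ↔ ¬ Even (y / 2 ^ h (x + y)))

theorem add_one_ediv_of_not_dvd {p y : ℤ} (hp : 0 < p) (h : ¬ p ∣ y + 1) :
    (y + 1) / p = y / p := by
  have h1 := Int.emod_add_mul_ediv y p
  have h2 := Int.emod_nonneg y hp.ne'
  have h3 := Int.emod_lt_of_pos y hp
  have h4 : y % p + 1 ≠ p := fun e => h ⟨y / p + 1, by linear_combination e - h1⟩
  exact Int.ediv_eq_iff_of_pos hp |>.2 ⟨by linarith, by
    have : y % p + 1 < p := by omega
    linarith⟩

theorem ediv_of_dvd_add_one {p y : ℤ} (hp : 0 < p) (h : p ∣ y + 1) :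
    y / p = (y + 1) / p - 1 := by
  obtain ⟨c, hc⟩ := h
  rw [hc, Int.mul_ediv_cancel_left _ hp.ne']
  refine Int.ediv_eq_iff_of_pos hp |>.2 ⟨by linarith, by linarith⟩

theorem even_ediv_iff {k : ℕ} {y : ℤ} (h : (2 : ℤ) ^ k ∣ y) :
    Even (y / 2 ^ k) ↔ (2 : ℤ) ^ (k + 1) ∣ y := by
  have hp : (0 : ℤ) < 2 ^ k := by positivity
  obtain ⟨c, rfl⟩ := h
  rw [Int.mul_ediv_cancel_left _ hp.ne', pow_succ, mul_dvd_mul_iff_left hp.ne', even_iff_two_dvd]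

/-- The quotient by `2 ^ k` changes parity between `y` and `y + 1` exactly if `2 ^ k ∣ y + 1`. -/
theorem even_add_one_ediv_iff {k : ℕ} {y : ℤ} :
    (Even ((y + 1) / 2 ^ k) ↔ Even (y / 2 ^ k)) ↔ ¬ (2 : ℤ) ^ k ∣ y + 1 := by
  have hp : (0 : ℤ) < 2 ^ k := by positivity
  by_cases h : (2 : ℤ) ^ k ∣ y + 1
  · rw [ediv_of_dvd_add_one hp h]
    rw [Int.even_sub_one]
    simp only [h, not_true_eq_false, iff_false]
    tauto
  · rw [add_one_ediv_of_not_dvd hp h]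
    simp [h]

theorem axis_signs_zero {t : Fin 6} (h : axis t = 0) :
    osign (1 - t) = true ∧ osign (4 - t) = true ∧ osign (2 - t) = false ∧ osign (5 - t) = false := by
  revert t; decide

theorem axis_signs_one {t : Fin 6} (h : axis t = 1) :
    osign (1 - t) = !osign (4 - t) ∧ osign (2 - t) = true ∧ osign (5 - t) = true := by
  revert t; decide

theorem axis_signs_two {t : Fin 6} (h : axis t = 2) :
    osign (1 - t) = false ∧ osign (4 - t) = false ∧ osign (2 - t) = !osign (5 - t) := by
  revert t; decide

theorem axis_eq_zero_of_signs {t : Fin 6} (h : osign (4 - t) = true) (h' : osign (5 - t) = false) :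
    axis t = 0 := by
  revert t; decide

theorem axis_ne_zero_of_signs {t : Fin 6} (h : osign (4 - t) = false ∨ osign (5 - t) = true) :
    axis t ≠ 0 := by
  revert t; decide

theorem axis_eq_two_of_signs {t : Fin 6} (h : osign (4 - t) = false) (h' : osign (5 - t) = false) :
    axis t = 2 := by
  revert t; decide

theorem levelAxis_eq_zero {i j : ℕ} : levelAxis i j = 0 ↔ i = j := by
  unfold levelAxis; split_ifs <;> simp_all

theorem levelAxis_eq_one {i j : ℕ} : levelAxis i j = 1 ↔ j < i := by
  unfold levelAxis; split_ifs <;> simp_all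

theorem levelAxis_eq_two {i j : ℕ} : levelAxis i j = 2 ↔ i < j := by
  unfold levelAxis; split_ifs <;> simp <;> omega

variable {a : ℤ × ℤ → Fin 6} {h : ℤ → ℕ}

/-- Once the axes of row `y + 1` are those prescribed by the levels, so are the sides on which the
R1-curves leave it. -/
theorem IsLevelRow.add_one (ha : Legal a) (hh : IsInterlaced h) {y : ℤ} (hy : IsLevelRow a h y)
    (hax : ∀ x, axis (a (x, y + 1)) = levelAxis (h x) (h (x + (y + 1)))) :
    IsLevelRow a h (y + 1) := by
  intro x
  refine ⟨hax x, ?_⟩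
  have hA := ha.up x y
  have hB := ha.upLeft x y
  have hA' := (hy x).2.1
  have hB' := (hy (x + 1)).2.2
  rw [show x + 1 + y = x + (y + 1) by ring] at hB'
  have e1 := even_add_one_ediv_iff (k := h x) (y := y)
  have e2 := even_add_one_ediv_iff (k := h (x + (y + 1))) (y := y)
  have f1 := hh.eq_iff (x := x) (y := y + 1)
  have f2 := hh.le_iff (x := x) (y := y + 1)
  have f3 := hh.eq_iff' (x := x) (y := y + 1)
  have f4 := hh.le_iff' (x := x) (y := y + 1)
  have g1 := fun hd => even_ediv_iff (k := h x) (y := y + 1) hd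
  have g2 := fun hd => even_ediv_iff (k := h (x + (y + 1))) (y := y + 1) hd
  have hax := hax x
  rcases lt_trichotomy (h x) (h (x + (y + 1))) with hlt | heq | hgt
  · rw [levelAxis_eq_two.2 hlt] at hax
    obtain ⟨s1, s2, s3⟩ := axis_signs_two hax
    have d1 := f2.1 hlt.le
    have d2 := mt f1.2 hlt.ne
    have d3 := mt f4.2 hlt.not_ge
    rw [s1, s3, g1 d1, e2.2 d3, ← hB'] 
    refine ⟨by simpa using d2, ?_⟩
    revert hB
    cases osign (2 - a (x + 1, y)) <;> cases osign (5 - a (x, y + 1)) <;> simp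
  · rw [levelAxis_eq_zero.2 heq] at hax
    obtain ⟨s1, s2, s3, s4⟩ := axis_signs_zero hax
    rw [s1, s3, g1 (f2.1 heq.le), g2 (f4.1 heq.ge)]
    simp [f1.1 heq, f3.1 heq]
  · rw [levelAxis_eq_one.2 hgt] at hax
    obtain ⟨s1, s2, s3⟩ := axis_signs_one hax
    have d1 := f4.1 hgt.le
    have d2 := mt f3.2 hgt.ne'
    have d3 := mt f2.2 hgt.not_ge
    rw [s2, s1, e1.2 d3, g2 d1, ← hA']
    refine ⟨?_, by simpa using d2⟩
    revert hA
    cases osign (1 - a (x, y)) <;> cases osign (4 - a (x, y + 1)) <;> simp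

/-- In a row of height `Y` with `2`-adic valuation `j`, the axes prescribed by the levels depend
only on the comparison of the level of the foot in direction `-2π/3` with `j`. -/
theorem IsInterlaced.levelAxis_eq (hh : IsInterlaced h) {Y : ℤ} {j : ℕ} (hj : (2 : ℤ) ^ j ∣ Y)
    (hj' : ¬ (2 : ℤ) ^ (j + 1) ∣ Y) (x : ℤ) :
    levelAxis (h x) (h (x + Y)) = if h x < j then 0 else if h x = j then 2 else 1 := by
  split_ifs with h1 h2
  · rw [levelAxis_eq_zero, hh.eq_iff]
    exact (pow_dvd_pow 2 h1).trans hj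
  · rw [levelAxis_eq_two, lt_iff_le_and_ne]
    refine ⟨hh.le_iff.2 (h2 ▸ hj), fun e => hj' (h2 ▸ hh.eq_iff.1 e)⟩
  · rw [levelAxis_eq_one, ← not_le, hh.le_iff]
    exact fun e => hj' ((pow_dvd_pow 2 (by omega)).trans e)

theorem IsInterlaced.shift_level (hh : IsInterlaced h) {j : ℕ} (x : ℤ) :
    (h x < j → h (x + 2 ^ j) = h x) ∧ (j ≤ h x → j ≤ h (x + 2 ^ j)) := by
  constructor
  · intro hx
    exact (hh.eq_iff.2 (pow_dvd_pow 2 hx)).symm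
  · intro hx
    by_contra! hlt
    have := hh.eq_iff' (x := x) (y := 2 ^ j) |>.2 (pow_dvd_pow 2 hlt)
    omega

/-- A row in which the sites of non-zero axis are those of level at least `j` alternates at
distance `2 ^ j`. -/
theorem axis_row_alternate (ha : Legal a) (hh : IsInterlaced h) {Y : ℤ} {j : ℕ}
    (h0 : ∀ x, h x < j → axis (a (x, Y)) = 0) (h1 : ∀ x, j ≤ h x → axis (a (x, Y)) ≠ 0)
    {x : ℤ} (hx : j ≤ h x) : axis (a (x, Y)) ≠ axis (a (x + 2 ^ j, Y)) := by
  have hax : axis 0 = 0 := rfl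
  have := axis_ne_of_run (b := fun i : ℕ => a (x + i, Y)) (d := 0) (N := 2 ^ j)
    (fun i => by
      have := ha.right (x + i) Y
      simpa [add_assoc] using this) (by positivity) (by simpa [hax] using h1 x hx)
    (fun i hi hi' => by
      refine h0 _ ?_
      by_contra! hge
      have := hh.dvd_of_le j hx hge
      have h2 : (2 : ℤ) ^ j ≤ i := Int.le_of_dvd (by exact_mod_cast hi) (by simpa using this)
      have h3 : (i : ℤ) < 2 ^ j := by exact_mod_cast hi'
      omega)
    (by simpa [hax] using h1 _ ((hh.shift_level x).2 hx))
  simpa using this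

/-- A row in which the sites of non-zero axis are those of level at least `j` is determined by the
alternation of the axes and by the axis of one site of level `j`. -/
theorem axis_row_of_pin (ha : Legal a) (hh : IsInterlaced h) {Y : ℤ} {j : ℕ}
    (h0 : ∀ x, h x < j → axis (a (x, Y)) = 0) (h1 : ∀ x, j ≤ h x → axis (a (x, Y)) ≠ 0)
    {x₀ : ℤ} (hx₀ : h x₀ = j) (hpin : axis (a (x₀, Y)) = 2) (x : ℤ) :
    axis (a (x, Y)) = if h x < j then 0 else if h x = j then 2 else 1 := by
  have hstep := fun x (hx : j ≤ h x) => (hh.shift_level x).2 hx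
  have halt := fun x hx => axis_row_alternate ha hh h0 h1 (x := x) hx
  have htwo : ∀ x, j ≤ h x → axis (a (x + 2 ^ (j + 1), Y)) = axis (a (x, Y)) := by
    intro x hx
    have e1 := halt x hx
    have e2 := halt _ (hstep x hx)
    have n1 := h1 x hx
    have n2 := h1 _ (hstep x hx)
    have n3 := h1 _ (hstep _ (hstep x hx))
    rw [show x + 2 ^ j + 2 ^ j = x + 2 ^ (j + 1) by ring] at e2 n3
    revert e1 e2 n1 n2 n3
    generalize axis (a (x, Y)) = p
    generalize axis (a (x + 2 ^ j, Y)) = q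
    generalize axis (a (x + 2 ^ (j + 1), Y)) = r
    revert p q r
    decide
  have hper : ∀ k : ℤ, ∀ x, j ≤ h x → j ≤ h (x + k * 2 ^ (j + 1)) ∧
      axis (a (x + k * 2 ^ (j + 1), Y)) = axis (a (x, Y)) := by
    intro k x hx
    have hge : ∀ k : ℤ, j ≤ h (x + k * 2 ^ (j + 1)) := by
      intro k
      by_contra! hlt
      have := hh.eq_iff' (x := x) (y := k * 2 ^ (j + 1)) |>.2
        (Dvd.dvd.mul_left (pow_dvd_pow 2 (by omega)) _)
      omega
    refine ⟨hge k, ?_⟩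
    induction k using Int.induction_on with
    | zero => simp
    | succ k ih =>
      rw [← ih, ← htwo _ (hge k)]
      congr 3
      ring
    | pred k ih =>
      rw [← ih, ← htwo _ (hge _)]
      congr 3
      ring
  split_ifs with hx hx'
  · exact h0 x hx
  · obtain ⟨c, hc⟩ := hh.dvd_of_eq (x := x₀) (y := x) (by omega)
    rw [hx₀] at hc
    rw [show x = x₀ + c * 2 ^ (j + 1) by linear_combination hc, (hper c x₀ hx₀.ge).2, hpin]
  · obtain ⟨c, hc⟩ := hh.dvd_of_le j (x := x₀ + 2 ^ j) (y := x) (hstep _ hx₀.ge) (by omega)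
    rcases Int.even_or_odd' c with ⟨r, rfl | rfl⟩
    · rw [show x = x₀ + 2 ^ j + r * 2 ^ (j + 1) by rw [pow_succ]; linear_combination hc,
        (hper r _ (hstep _ hx₀.ge)).2]
      have e1 := halt x₀ hx₀.ge
      have n1 := h1 _ (hstep x₀ hx₀.ge)
      rw [hpin] at e1
      revert e1 n1
      generalize axis (a (x₀ + 2 ^ j, Y)) = q
      revert q; decide
    · exfalso
      have : h x = h x₀ := hh.eq_of_dvd ⟨r + 1, by
        rw [hx₀, pow_succ]; linear_combination hc⟩
      omega

/-- Exchanging the positions of level `j` with those of higher level does not affect the rows below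
height `2 ^ j`. -/
theorem IsLevelRow.shift (hh : IsInterlaced h) {j : ℕ} {y : ℤ} (hy : IsLevelRow a h y)
    (h0 : 0 ≤ y) (hlt : y < 2 ^ j) : IsLevelRow a (fun n => h (n + 2 ^ j)) y := by
  have hev : ∀ x, y / 2 ^ h (x + 2 ^ j) = y / 2 ^ h x := by
    intro x
    rcases lt_or_ge (h x) j with hx | hx
    · rw [(hh.shift_level x).1 hx]
    · have hx' := (hh.shift_level x).2 hx
      rw [Int.ediv_eq_zero_of_lt h0 (hlt.trans_le (pow_le_pow_right₀ (by norm_num) hx)),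
        Int.ediv_eq_zero_of_lt h0 (hlt.trans_le (pow_le_pow_right₀ (by norm_num) hx'))]
  intro x
  obtain ⟨h1, h2, h3⟩ := hy x
  refine ⟨?_, by simpa only [hev] using h2, by simpa only [hev] using h3⟩
  rw [h1]
  rcases h0.eq_or_lt with rfl | hpos
  · simp [levelAxis]
  have hnot : ¬ (j ≤ h x ∧ j ≤ h (x + y)) := by
    rintro ⟨p, q⟩
    have := Int.le_of_dvd hpos (by simpa using hh.dvd_of_le j p q)
    omega
  obtain ⟨p1, p2⟩ := hh.shift_level (j := j) x
  obtain ⟨q1, q2⟩ := hh.shift_level (j := j) (x + y)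
  simp only [levelAxis]
  split_ifs <;> first | rfl | (exfalso; omega)

/-- The row above rows that follow the levels `h` follows them as well, except at the heights
`2 ^ j`, where the alternation leaves two possibilities, exchanged by a shift of `h`. -/
theorem exists_isLevelRow_add_one (ha : Legal a) (hh : IsInterlaced h) {y : ℤ} (hy0 : 0 ≤ y)
    (hy : ∀ z, 0 ≤ z → z ≤ y → IsLevelRow a h z) :
    ∃ h' : ℤ → ℕ, IsInterlaced h' ∧ ∀ z, 0 ≤ z → z ≤ y + 1 → IsLevelRow a h' z := by
  have hyy := hy y hy0 le_rfl
  set Y := y + 1 with hY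
  obtain ⟨j, hj, hj'⟩ : ∃ j : ℕ, (2 : ℤ) ^ j ∣ Y ∧ ¬ (2 : ℤ) ^ (j + 1) ∣ Y := by
    have hfin : FiniteMultiplicity (2 : ℤ) Y :=
      Int.finiteMultiplicity_iff.2 ⟨by decide, by omega⟩
    exact ⟨multiplicity 2 Y, pow_multiplicity_dvd _ _,
      hfin.not_pow_dvd_of_multiplicity_lt (Nat.lt_succ_self _)⟩
  have hY0 : 0 < Y := by omega
  have hB' : ∀ x, (osign (2 - a (x + 1, y)) = true ↔ ¬ Even (y / 2 ^ h (x + Y))) := by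
    intro x
    have := (hyy (x + 1)).2.2
    rwa [show x + 1 + y = x + Y by omega] at this
  have par : ∀ k : ℕ, (2 : ℤ) ^ k ∣ Y → (Even (y / 2 ^ k) ↔ ¬ (2 : ℤ) ^ (k + 1) ∣ Y) := by
    intro k hk
    rw [← even_ediv_iff hk, ediv_of_dvd_add_one (by positivity) hk, Int.even_sub_one]
  have sA : ∀ x, Even (y / 2 ^ h x) → osign (4 - a (x, Y)) = false := by
    intro x hx
    have h1 := ha.up x y
    rw [(hyy x).2.1.2 hx] at h1
    simpa using h1.symm
  have sA' : ∀ x, ¬ Even (y / 2 ^ h x) → osign (4 - a (x, Y)) = true := by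
    intro x hx
    have h1 := ha.up x y
    rw [Bool.eq_false_iff.2 (mt (hyy x).2.1.1 hx)] at h1
    simpa using h1.symm
  have sB : ∀ x, Even (y / 2 ^ h (x + Y)) → osign (5 - a (x, Y)) = true := by
    intro x hx
    have h1 := ha.upLeft x y
    rw [Bool.eq_false_iff.2 fun e => (hB' x).1 e hx] at h1
    simpa using h1.symm
  have sB' : ∀ x, ¬ Even (y / 2 ^ h (x + Y)) → osign (5 - a (x, Y)) = false := by
    intro x hx
    have h1 := ha.upLeft x y
    rw [(hB' x).2 hx] at h1
    simpa using h1.symm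
  have hzero : ∀ x, h x < j → axis (a (x, Y)) = 0 := by
    intro x hx
    have hd : (2 : ℤ) ^ (h x + 1) ∣ Y := (pow_dvd_pow 2 hx).trans hj
    have he := hh.eq_iff.2 hd
    have hne : ¬ Even (y / 2 ^ h x) := by
      rw [par _ ((pow_dvd_pow 2 (Nat.le_succ _)).trans hd)]
      simpa using hd
    exact axis_eq_zero_of_signs (sA' x hne) (sB' x (he ▸ hne))
  have hnonzero : ∀ x, j ≤ h x → axis (a (x, Y)) ≠ 0 := by
    intro x hx
    apply axis_ne_zero_of_signs
    rcases hx.eq_or_lt with e | hlt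
    · left
      exact sA x (e ▸ (par _ hj).2 hj')
    · right
      have h1 : ¬ (2 : ℤ) ^ h x ∣ Y := fun e => hj' ((pow_dvd_pow 2 hlt).trans e)
      have h2 : h (x + Y) < h x := by rwa [← not_le, hh.le_iff]
      have h3 := hh.le_iff'.1 h2.le
      exact sB x ((par _ h3).2 (mt hh.eq_iff'.2 h2.ne'))
  -- It remains to find the axis of one site of level `j`.
  have finish : ∀ g : ℤ → ℕ, IsInterlaced g → (∀ z, 0 ≤ z → z ≤ y → IsLevelRow a g z) →
      (∀ x, g x < j ↔ h x < j) → (∃ x₀, g x₀ = j ∧ axis (a (x₀, Y)) = 2) →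
      ∃ h' : ℤ → ℕ, IsInterlaced h' ∧ ∀ z, 0 ≤ z → z ≤ Y → IsLevelRow a h' z := by
    rintro g hg hgy hgj ⟨x₀, hx₀, hpin⟩
    refine ⟨g, hg, fun z hz hzY => ?_⟩
    rcases hzY.eq_or_lt with rfl | hlt
    · refine IsLevelRow.add_one ha hg (hgy y hy0 le_rfl) fun x => ?_
      rw [hg.levelAxis_eq hj hj']
      exact axis_row_of_pin ha hg (fun x hx => hzero x ((hgj x).1 hx))
        (fun x hx => hnonzero x (by have := hgj x; omega)) hx₀ hpin x
    · exact hgy z hz (by omega)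
  have hp : (0 : ℤ) < 2 ^ j := by positivity
  by_cases hpow : Y = 2 ^ j
  · obtain ⟨x₀, hx₀⟩ := hh.exists_eq j
    by_cases hax : axis (a (x₀, Y)) = 2
    · exact finish h hh hy (fun _ => Iff.rfl) ⟨x₀, hx₀, hax⟩
    · refine finish (fun n => h (n + 2 ^ j)) (hh.comp_add _)
        (fun z hz hzy => (hy z hz hzy).shift hh hz (by omega)) (fun x => ?_) ⟨x₀ + 2 ^ j, ?_, ?_⟩
      · have := hh.shift_level (j := j) x
        constructor
        · intro hx; by_contra! h'; have := this.2 h'; omega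
        · intro hx; rw [this.1 hx]; exact hx
      · rw [← hx₀]
        refine hh.eq_of_dvd ⟨1, ?_⟩
        rw [hx₀, pow_succ]; ring
      · have hge := (hh.shift_level (j := j) x₀).2 hx₀.ge
        have n1 := hnonzero _ hx₀.ge
        have n2 := hnonzero _ hge
        have e1 := axis_row_alternate ha hh hzero hnonzero hx₀.ge
        revert e1 n1 n2 hax
        generalize axis (a (x₀, Y)) = p
        generalize axis (a (x₀ + 2 ^ j, Y)) = q
        revert p q; decide
  · -- A foot of level `m`, where `2 ^ m < Y < 2 ^ (m + 1)`, has its first corner below `Y`.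
    obtain ⟨m, hm, hm'⟩ : ∃ m : ℕ, (2 : ℤ) ^ m ≤ Y ∧ Y < 2 ^ (m + 1) := by
      obtain ⟨N, hN⟩ := Int.eq_ofNat_of_zero_le hY0.le
      refine ⟨Nat.log 2 N, ?_, ?_⟩
      · rw [hN]; exact_mod_cast Nat.pow_log_le_self 2 (by omega)
      · rw [hN]; exact_mod_cast Nat.lt_pow_succ_log_self (by norm_num) N
    have hjm : j < m := by
      by_contra! hle
      rcases hle.eq_or_lt with rfl | hlt
      · obtain ⟨c, hc⟩ := hj
        have hc1 : c ≠ 1 := by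
          rintro rfl
          exact hpow (by rw [hc, mul_one])
        have hc2 : c < 2 := by
          by_contra! h
          rw [pow_succ] at hm'
          nlinarith
        nlinarith [show c ≤ 0 by omega]
      · exact (Int.le_of_dvd hY0 ((pow_dvd_pow 2 hlt).trans hj)).not_gt hm'
    obtain ⟨n, hn⟩ := hh.exists_eq m
    have hx : h (n - Y + Y) = m := by simpa using hn
    have hxm : h (n - Y) < m := by
      rw [← hx, ← not_le, hh.le_iff', hx]
      exact fun e => hj' ((pow_dvd_pow 2 hjm).trans e)
    have hxj : h (n - Y) = j := by
      have h1 := hh.le_iff.1 (hx ▸ hxm).le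
      have h2 := mt hh.eq_iff.2 (hx ▸ hxm).ne
      apply le_antisymm
      · by_contra! hlt
        exact hj' ((pow_dvd_pow 2 hlt).trans h1)
      · by_contra! hlt
        exact h2 ((pow_dvd_pow 2 hlt).trans hj)
    refine finish h hh hy (fun _ => Iff.rfl) ⟨n - Y, hxj, axis_eq_two_of_signs (sA _ ?_) (sB' _ ?_)⟩
    · rw [hxj]
      exact (par _ hj).2 hj'
    · rw [hx, show y / 2 ^ m = 1 from Int.ediv_eq_iff_of_pos (by positivity) |>.2 ⟨?_, ?_⟩]
      · decide
      · have : Y ≠ 2 ^ m := fun e => hj' (e ▸ pow_dvd_pow 2 hjm)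
        omega
      · rw [pow_succ] at hm'
        omega

/-- Up to any height, the half-plane above a line follows some interlaced levels. -/
theorem exists_isLevelRow_le (ha : Legal a) (hrow : ∀ x, axis (a (x, 0)) = 0) (y : ℕ) :
    ∃ h : ℤ → ℕ, IsInterlaced h ∧ ∀ z : ℤ, 0 ≤ z → z ≤ y → IsLevelRow a h z := by
  induction y with
  | zero =>
    obtain ⟨h, hh⟩ := exists_isInterlaced
    refine ⟨h, hh, fun z hz hz' x => ?_⟩
    obtain rfl : z = 0 := by push_cast at hz'; omega
    obtain ⟨s1, -, s3, -⟩ := axis_signs_zero (hrow x)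
    simp [hrow, levelAxis, s1, s3]
  | succ y ih =>
    obtain ⟨h, hh, hy⟩ := ih
    obtain ⟨h', hh', hy'⟩ := exists_isLevelRow_add_one ha hh (Int.natCast_nonneg y) hy
    exact ⟨h', hh', by exact_mod_cast hy'⟩

/-- The level of a position of the line is read off the column above it. -/
theorem IsInterlaced.levelAxis_column (hh : IsInterlaced h) (n : ℤ) {t : ℤ} (ht : 0 < t) :
    (t < 2 ^ h n → levelAxis (h n) (h (n + t)) = 1) ∧
      (t = 2 ^ h n → levelAxis (h n) (h (n + t)) = 2) := by
  constructor
  · intro hlt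
    rw [levelAxis_eq_one, ← not_le, hh.le_iff]
    exact fun e => (Int.le_of_dvd ht e).not_gt hlt
  · rintro rfl
    rw [levelAxis_eq_two, lt_iff_le_and_ne, hh.le_iff, Ne, hh.eq_iff]
    refine ⟨dvd_rfl, fun e => ?_⟩
    have := Int.le_of_dvd (by positivity) e
    rw [pow_succ] at this
    have : (0 : ℤ) < 2 ^ h n := by positivity
    omega

/-- The same for the other column above the position. -/
theorem IsInterlaced.levelAxis_column' (hh : IsInterlaced h) (n : ℤ) {t : ℤ} (ht : 0 < t) :
    (t < 2 ^ h n → levelAxis (h (n - t)) (h n) = 2) ∧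
      (t = 2 ^ h n → levelAxis (h (n - t)) (h n) = 1) := by
  have e1 := hh.le_iff' (x := n - t) (y := t)
  have e2 := hh.eq_iff' (x := n - t) (y := t)
  rw [sub_add_cancel] at e1 e2
  constructor
  · intro hlt
    rw [levelAxis_eq_two, ← not_le, e1]
    exact fun e => (Int.le_of_dvd ht e).not_gt hlt
  · intro hteq
    rw [levelAxis_eq_one, lt_iff_le_and_ne, e1, ne_comm, Ne, e2, hteq]
    refine ⟨dvd_rfl, fun e => ?_⟩
    have := Int.le_of_dvd (by positivity) e
    rw [pow_succ] at this
    have : (0 : ℤ) < 2 ^ h n := by positivity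
    omega

theorem IsInterlaced.level_eq_of_column_eq {h' : ℤ → ℕ} (hh : IsInterlaced h)
    (hh' : IsInterlaced h') {n n' : ℤ}
    (he : ∀ t : ℤ, 0 < t → t ≤ 2 ^ h n → t ≤ 2 ^ h' n' →
      levelAxis (h n) (h (n + t)) = levelAxis (h' n') (h' (n' + t))) : h n = h' n' := by
  have aux : ∀ {g g' : ℤ → ℕ}, IsInterlaced g → IsInterlaced g' → ∀ {n n' : ℤ},
      (∀ t : ℤ, 0 < t → t ≤ 2 ^ g n → t ≤ 2 ^ g' n' →
      levelAxis (g n) (g (n + t)) = levelAxis (g' n') (g' (n' + t))) → ¬ g n < g' n' := by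
    intro g g' hg hg' n n' he hlt
    have hp : (0 : ℤ) < 2 ^ g n := by positivity
    have h1 : (2 : ℤ) ^ g n < 2 ^ g' n' := pow_lt_pow_right₀ (by norm_num) hlt
    have h2 := he _ hp le_rfl h1.le
    rw [(hg.levelAxis_column n hp).2 rfl, (hg'.levelAxis_column n' hp).1 h1] at h2
    simp at h2
  have h1 := aux hh hh' he
  have h2 := aux hh' hh fun t h0 h1 h2 => (he t h0 h2 h1).symm
  omega

/-- The half-plane above a bi-infinite line follows interlaced levels, unless the R1-curve at some
position of the line runs up straight to infinity. -/
theorem exists_isLevelRow (ha : Legal a) (hrow : ∀ x, axis (a (x, 0)) = 0)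
    (hray : ∀ x, ¬ ∀ t : ℤ, 0 < t → axis (a (x, t)) = 1) :
    ∃ h : ℤ → ℕ, IsInterlaced h ∧ ∀ y : ℤ, 0 ≤ y → IsLevelRow a h y := by
  choose g hg hgy using exists_isLevelRow_le ha hrow
  have agree : ∀ (m m' : ℕ) (n : ℤ), 2 ^ g m n ≤ m → m ≤ m' → g m n = g m' n := by
    intro m m' n hm hmm
    refine (hg m).level_eq_of_column_eq (hg m') fun t ht0 ht _ => ?_
    have hm2 : (2 : ℤ) ^ g m n ≤ m := by exact_mod_cast hm
    rw [← (hgy m t ht0.le (by omega) n).1, ← (hgy m' t ht0.le (by omega) n).1]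
  have hex : ∀ n, ∃ m : ℕ, 2 ^ g m n ≤ m := by
    intro n
    by_contra! hlt
    refine hray n fun t ht => ?_
    obtain ⟨m, rfl⟩ := Int.eq_ofNat_of_zero_le ht.le
    rw [(hgy m m ht.le le_rfl n).1]
    exact ((hg m).levelAxis_column n ht).1 (by exact_mod_cast hlt m)
  choose M hM using hex
  have hlim : ∀ n m, M n ≤ m → g m n = g (M n) n := fun n m hm => (agree _ _ n (hM n) hm).symm
  have hlim' : ∀ n (m : ℕ), 2 ^ g m n ≤ m → g m n = g (M n) n := fun n m hm => by
    rcases le_total (M n) m with h1 | h1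
    · exact hlim n m h1
    · exact agree _ _ n hm h1
  refine ⟨fun n => g (M n) n, fun m => ?_, fun y hy x => ?_⟩
  · obtain ⟨l, hl⟩ := hg (2 ^ m) m
    refine ⟨l, fun n => Iff.trans ?_ (hl n)⟩
    constructor
    · intro e
      beta_reduce at e
      have h1 := hlim n (max (M n) (2 ^ m)) (le_max_left _ _)
      -- Both `g (2 ^ m)` and a later approximation describe the column up to height `2 ^ m`.
      refine Eq.trans ?_ (h1.trans e)
      refine (hg _).level_eq_of_column_eq (hg _) fun t ht0 _ ht => ?_
      rw [h1, e] at ht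
      have ht' : t ≤ ((2 ^ m : ℕ) : ℤ) := by exact_mod_cast ht
      have ht2 : ((2 ^ m : ℕ) : ℤ) ≤ ((max (M n) (2 ^ m) : ℕ) : ℤ) := by
        exact_mod_cast le_max_right _ _
      rw [← (hgy (2 ^ m) t ht0.le ht' n).1,
        ← (hgy _ t ht0.le (ht'.trans ht2) n).1]
    · intro e
      beta_reduce
      rw [← hlim' n (2 ^ m) (by rw [e]), e]
  · obtain ⟨Y, rfl⟩ := Int.eq_ofNat_of_zero_le hy
    set m := max Y (max (M x) (M (x + Y))) with hm
    have hYm : Y ≤ m := le_max_left _ _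
    have h1 := hlim x m (by omega)
    have h2 := hlim (x + Y) m (by omega)
    have h3 := hgy m Y hy (by exact_mod_cast hYm) x
    simp only at h3 ⊢
    rwa [h1, h2] at h3

/-! ### Hexagons centred at the sites of the triangular lattice -/

theorem dir_eq_pow (i : Fin 6) : dir i = dir 1 ^ (i : ℕ) := by
  rw [dir, dir, ← Complex.exp_nat_mul, show ((1 : Fin 6) : ℕ) = 1 from rfl]
  congr 1
  push_cast
  ring

theorem dir_one : dir 1 = 1 / 2 + (√3 / 2 : ℝ) * Complex.I := by
  have : dir 1 = Complex.exp ((Real.pi / 3 : ℝ) * Complex.I) := by simp [dir]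
  rw [this, Complex.exp_mul_I, ← Complex.ofReal_cos, ← Complex.ofReal_sin, Real.cos_pi_div_three,
    Real.sin_pi_div_three]
  simp

theorem dir_one_re : (dir 1).re = 1 / 2 := by simp [dir_one]

theorem dir_one_im : (dir 1).im = √3 / 2 := by simp [dir_one]

theorem dir_one_sq : dir 1 ^ 2 = dir 1 - 1 := by
  apply Complex.ext
  · rw [pow_two, Complex.mul_re, Complex.sub_re, dir_one_re, dir_one_im, Complex.one_re]
    have := Real.mul_self_sqrt (show (0 : ℝ) ≤ 3 by norm_num)
    linarith
  · rw [pow_two, Complex.mul_im, Complex.sub_im, dir_one_re, dir_one_im, Complex.one_im]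
    ring

theorem dir_one_pow_three : dir 1 ^ 3 = -1 := by
  linear_combination (dir 1 + 1) * dir_one_sq

theorem dir_zero : dir 0 = 1 := by rw [dir_eq_pow]; simp

theorem dir_add (i j : Fin 6) : dir (i + j) = dir i * dir j := by
  have h6 : dir 1 ^ 6 = 1 := by
    linear_combination (dir 1 ^ 3 - 1) * dir_one_pow_three
  rw [dir_eq_pow, dir_eq_pow i, dir_eq_pow j, ← pow_add, Fin.val_add, ← pow_eq_pow_mod _ h6]

theorem dir_three : dir 3 = -1 := by
  rw [dir_eq_pow, ← dir_one_pow_three]; rfl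

theorem dir_add_three (i : Fin 6) : dir (i + 3) = -dir i := by
  rw [dir_add, dir_three, mul_neg_one]

theorem dir_ne_zero (i : Fin 6) : dir i ≠ 0 := Complex.exp_ne_zero _

/-- The point of `ℂ` at the lattice site `s`. -/
noncomputable def siteVec (s : ℤ × ℤ) : ℂ := s.1 + s.2 * dir 1

theorem siteVec_add (s t : ℤ × ℤ) : siteVec (s + t) = siteVec s + siteVec t := by
  simp [siteVec]; ring

theorem siteVec_step (d : Fin 6) : siteVec (step d) = dir d := by
  have h2 := dir_one_sq
  rw [dir_eq_pow]
  fin_cases d <;> simp [siteVec, step]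
  · linear_combination -h2
  · linear_combination -dir_one_pow_three
  · linear_combination -dir 1 * dir_one_pow_three
  · linear_combination -dir 1 ^ 2 * dir_one_pow_three + h2

theorem siteVec_injective : Function.Injective siteVec := by
  intro s t h
  have him := congrArg Complex.im h
  have hre := congrArg Complex.re h
  simp only [siteVec, Complex.add_im, Complex.mul_im, Complex.intCast_im, Complex.intCast_re,
    Complex.add_re, Complex.mul_re, dir_one_re, dir_one_im] at him hre
  have h3 : (0 : ℝ) < √3 := by positivity
  have h2 : (s.2 : ℝ) = t.2 := by
    apply mul_right_cancel₀ h3.ne'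
    linarith
  have h1 : (s.1 : ℝ) = t.1 := by rw [h2] at hre; linarith
  exact Prod.ext (by exact_mod_cast h1) (by exact_mod_cast h2)

theorem step_injective : Function.Injective step := by decide

theorem dir_injective : Function.Injective dir := by
  intro i j h
  rw [← siteVec_step, ← siteVec_step] at h
  exact step_injective (siteVec_injective h)

/-- The rotation by `i * π / 3`. -/
noncomputable def unitRot (i : Fin 6) : Circle := Circle.exp ((i : ℕ) * (Real.pi / 3))

theorem coe_unitRot (i : Fin 6) : (unitRot i : ℂ) = dir i := by
  rw [unitRot, Circle.coe_exp, dir]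
  push_cast
  rfl

theorem unitRot_add (i j : Fin 6) : unitRot (i + j) = unitRot i * unitRot j := by
  ext; simp [coe_unitRot, dir_add]

/-- The tile at the lattice site `s`, rotated by `i * π / 3`, in the lattice spanned by the tile `f`
and its neighbours. -/
noncomputable def siteTile (f : Tile) (s : ℤ × ℤ) (i : Fin 6) : Tile :=
  ⟨f.rot * unitRot i, f.center + f.rot * siteVec s⟩

theorem siteTile_zero (f : Tile) : siteTile f 0 0 = f := by
  ext <;> simp [siteTile, siteVec, coe_unitRot, dir_zero]

theorem siteTile_injective {f : Tile} {s t : ℤ × ℤ} {i j : Fin 6}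
    (h : siteTile f s i = siteTile f t j) : s = t ∧ i = j := by
  have h1 := congrArg Tile.center h
  have h2 := congrArg Tile.rot h
  simp only [siteTile, add_right_inj, mul_right_inj] at h1 h2
  have h2 := congrArg (fun c : Circle => (c : ℂ)) h2
  beta_reduce at h2
  rw [coe_unitRot, coe_unitRot] at h2
  exact ⟨siteVec_injective (mul_left_cancel₀ f.rot.coe_ne_zero h1), dir_injective h2⟩

theorem siteTile_siteTile (f : Tile) (s : ℤ × ℤ) (i : Fin 6) :
    siteTile (siteTile f 0 3) s i = siteTile f (-s) (3 + i) := by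
  ext
  · simp [siteTile, unitRot_add, mul_assoc]
  · simp [siteTile, siteVec, coe_unitRot, dir_three]; ring

theorem normal_siteTile (f : Tile) (s : ℤ × ℤ) (i j : Fin 6) :
    (siteTile f s i).normal j = f.rot * dir (i + j) := by
  simp [Tile.normal, siteTile, coe_unitRot, dir_add, mul_assoc]

/-! ### Adjacent tiles -/

theorem sharesEdge_iff {p q : Tile} {i j : Fin 6} :
    SharesEdge p i q j ↔ q.center = p.center + p.normal i ∧ p.normal i = -q.normal j := by
  simp only [SharesEdge, Tile.edgeMid, Tile.place, Tile.normal]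
  constructor
  · rintro ⟨h1, h2⟩
    exact ⟨by linear_combination -h1 - h2 / 2, h2⟩
  · rintro ⟨h1, h2⟩
    exact ⟨by linear_combination -h1 - h2 / 2, h2⟩

theorem SharesEdge.symm {p q : Tile} {i j : Fin 6} (h : SharesEdge p i q j) :
    SharesEdge q j p i :=
  ⟨h.1.symm, by rw [h.2, neg_neg]⟩

theorem R1Joined.symm {p q : Tile} {i j : Fin 6} (h : R1Joined p i q j) : R1Joined q j p i :=
  ⟨h.1.symm, h.2.symm⟩

theorem offset_eq (i : Fin 6) : offset i = if osign i then 1 else -1 := by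
  fin_cases i <;> simp [offset, osign]

theorem r1Joined_iff {p q : Tile} {i j : Fin 6} :
    R1Joined p i q j ↔ SharesEdge p i q j ∧ osign i ≠ osign j := by
  refine and_congr_right fun h => ?_
  have key : p.r1End i - q.r1End j = p.normal i * Complex.I / 8 * ((offset i + offset j : ℝ) : ℂ) := by
    have h1 := h.1
    have h2 := h.2
    simp only [Tile.edgeMid, Tile.place, Tile.normal, Tile.r1End] at h1 h2 ⊢
    push_cast
    linear_combination h1 - (offset j / 8 : ℂ) * Complex.I * h2
  have hne : p.normal i * Complex.I / 8 ≠ 0 := by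
    simp [Tile.normal, dir_ne_zero]
  rw [← sub_eq_zero, key, mul_eq_zero, or_iff_right hne, Complex.ofReal_eq_zero, offset_eq,
    offset_eq]
  cases osign i <;> cases osign j <;> norm_num

theorem sharesEdge_siteTile_iff {f q : Tile} {s : ℤ × ℤ} {k i j : Fin 6} :
    SharesEdge (siteTile f s k) i q j ↔ q = siteTile f (s + step (k + i)) (k + i + 3 - j) := by
  rw [sharesEdge_iff, normal_siteTile]
  have hc : (siteTile f s k).center + f.rot * dir (k + i) =
      (siteTile f (s + step (k + i)) (k + i + 3 - j)).center := by
    simp only [siteTile, siteVec_add, siteVec_step]; ring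
  have hd : -(f.rot * dir (k + i)) = f.rot * dir (k + i + 3 - j) * dir j := by
    rw [mul_assoc, ← dir_add, sub_add_cancel, dir_add_three, mul_neg]
  rw [hc]
  constructor
  · rintro ⟨h1, h2⟩
    refine Tile.ext (Circle.ext ?_) h1
    rw [siteTile, Circle.coe_mul, coe_unitRot]
    apply mul_right_cancel₀ (dir_ne_zero j)
    rw [← hd, h2, neg_neg, Tile.normal]
  · rintro rfl
    refine ⟨rfl, ?_⟩
    rw [normal_siteTile, sub_add_cancel, dir_add_three, mul_neg, neg_neg]

theorem r1Joined_siteTile_iff {f q : Tile} {s : ℤ × ℤ} {k i j : Fin 6} :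
    R1Joined (siteTile f s k) i q j ↔
      q = siteTile f (s + step (k + i)) (k + i + 3 - j) ∧ osign i ≠ osign j := by
  rw [r1Joined_iff, sharesEdge_siteTile_iff]

/-! ### Tilings as orientations of the lattice sites -/

/-- The tiling with a tile rotated by `a s * π / 3` at each site `s` of the lattice spanned by
the tile `f` and its neighbours. -/
def latticeTiling (f : Tile) (a : ℤ × ℤ → Fin 6) : Set Tile :=
  Set.range fun s => siteTile f s (a s)

theorem siteTile_mem_latticeTiling {f : Tile} {a : ℤ × ℤ → Fin 6} {s : ℤ × ℤ} {k : Fin 6} :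
    siteTile f s k ∈ latticeTiling f a ↔ k = a s := by
  constructor
  · rintro ⟨t, ht⟩
    obtain ⟨rfl, rfl⟩ := siteTile_injective ht
    rfl
  · rintro rfl
    exact ⟨s, rfl⟩

/-- The tiling `latticeTiling f a` seen from the tile `f` rotated by `π`. -/
theorem latticeTiling_rotate (f : Tile) (a : ℤ × ℤ → Fin 6) :
    latticeTiling (siteTile f 0 3) (fun s => a (-s) + 3) = latticeTiling f a := by
  have h : ∀ i : Fin 6, 3 + (i + 3) = i := by decide
  ext p
  constructor
  · rintro ⟨s, rfl⟩
    exact ⟨-s, by simp only [siteTile_siteTile, h]⟩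
  · rintro ⟨s, rfl⟩
    exact ⟨-s, by simp only [siteTile_siteTile, h, neg_neg]⟩

theorem Legal.rotate {a : ℤ × ℤ → Fin 6} (ha : Legal a) : Legal fun s => a (-s) + 3 := by
  intro s d
  have h1 := ha (-s) (d + 3)
  have h2 : step (d + 3) = -step d := by clear h1; revert d; decide
  have h3 : ∀ t : Fin 6, d + 3 - t = d - (t + 3) := by clear h1 h2; revert d; decide
  have h4 : ∀ t : Fin 6, d + 3 + 3 - t = d + 3 - (t + 3) := by clear h1 h2 h3; revert d; decide
  rwa [h2, ← neg_add, h3, h4] at h1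

theorem satisfiesR1_latticeTiling_iff {f : Tile} {a : ℤ × ℤ → Fin 6} :
    SatisfiesR1 (latticeTiling f a) ↔ Legal a := by
  constructor
  · intro h s d
    obtain ⟨q, hq, j, hj⟩ := h _ ⟨s, rfl⟩ (d - a s)
    obtain ⟨rfl, h2⟩ := r1Joined_siteTile_iff.1 hj
    rw [add_sub_cancel] at hq
    have := siteTile_mem_latticeTiling.1 hq
    rw [← this]
    simpa using h2
  · rintro h _ ⟨s, rfl⟩ i
    have h1 := h s (a s + i)
    refine ⟨_, ⟨s + step (a s + i), rfl⟩, a s + i + 3 - a (s + step (a s + i)), ?_⟩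
    rw [r1Joined_siteTile_iff]
    refine ⟨by simp, by simpa using h1⟩

/-- The open hexagon with the same edges as `hexagon`. -/
def openHexagon : Set ℂ := {z | ∀ i : Fin 6, (z * (starRingEnd ℂ) (dir i)).re < 1 / 2}

theorem interior_hexagon : interior hexagon = openHexagon := by
  apply Set.Subset.antisymm
  · intro z hz i
    have hc : Continuous fun t : ℝ => z + t * dir i := by fun_prop
    have h0 : (fun t : ℝ => z + t * dir i) 0 ∈ interior hexagon := by simpa using hz
    have h1 := hc.continuousAt.eventually (isOpen_interior.mem_nhds h0)
    obtain ⟨ε, hε, hball⟩ := Metric.eventually_nhds_iff.1 h1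
    have h2 := interior_subset (hball (y := ε / 2) (by
      rw [dist_zero_right, Real.norm_eq_abs, abs_of_pos (by positivity)]; linarith)) i
    have h3 : dir i * (starRingEnd ℂ) (dir i) = 1 := by
      rw [← coe_unitRot, Complex.mul_conj, Circle.normSq_coe]; simp
    rw [add_mul, mul_assoc, h3] at h2
    simp at h2
    simp
    linarith
  · apply interior_maximal
    · intro z hz i
      exact (hz i).le
    · rw [openHexagon, Set.ofPred_forall]
      exact isOpen_iInter_of_finite fun i => isOpen_lt (by fun_prop) continuous_const

theorem convex_hexagon : Convex ℝ hexagon := by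
  rw [hexagon, Set.ofPred_forall]
  refine convex_iInter fun i => convex_halfSpace_le ⟨fun x y => ?_, fun c x => ?_⟩ _
  · rw [add_mul, Complex.add_re]
  · rw [smul_mul_assoc, Complex.smul_re]

theorem zero_mem_openHexagon : (0 : ℂ) ∈ openHexagon := by
  intro i; simp

/-- The placement of a tile, as a homeomorphism. -/
noncomputable def Tile.placeHomeomorph (p : Tile) : ℂ ≃ₜ ℂ :=
  (Homeomorph.mulLeft₀ (p.rot : ℂ) p.rot.coe_ne_zero).trans (Homeomorph.addRight p.center)

theorem Tile.image_placeHomeomorph (p : Tile) (s : Set ℂ) :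
    p.placeHomeomorph '' s = p.place '' s := rfl

theorem interior_support (p : Tile) : interior p.support = p.place '' openHexagon := by
  rw [Tile.support, ← p.image_placeHomeomorph, ← Homeomorph.image_interior, interior_hexagon]
  rfl

theorem center_mem_interior_support (p : Tile) : p.center ∈ interior p.support := by
  rw [interior_support]
  exact ⟨0, zero_mem_openHexagon, by simp [Tile.place]⟩

theorem support_subset_closure_interior (p : Tile) : p.support ⊆ closure (interior p.support) := by
  have h := convex_hexagon.closure_interior_eq_closure_of_nonempty_interior
    ⟨0, by rw [interior_hexagon]; exact zero_mem_openHexagon⟩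
  rw [interior_support, ← p.image_placeHomeomorph, ← p.placeHomeomorph.image_closure,
    ← interior_hexagon, h]
  exact Set.image_mono subset_closure

/-- The projections to the edge normals of a point given in the lattice basis. -/
theorem re_mul_conj_dir (u v : ℝ) (P : ℝ → Prop) :
    (∀ i, P (((u + v * dir 1 : ℂ) * (starRingEnd ℂ) (dir i)).re)) ↔
      P (u + v / 2) ∧ P (u / 2 + v) ∧ P ((v - u) / 2) ∧
        P (-(u + v / 2)) ∧ P (-(u / 2 + v)) ∧ P (-((v - u) / 2)) := by
  have h3 := Real.mul_self_sqrt (show (0 : ℝ) ≤ 3 by norm_num)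
  have e0 : ((u + v * dir 1 : ℂ) * (starRingEnd ℂ) (dir 0)).re = u + v / 2 := by
    rw [dir_zero]; simp [dir_one_re]; ring
  have e1 : ((u + v * dir 1 : ℂ) * (starRingEnd ℂ) (dir 1)).re = u / 2 + v := by
    simp [dir_one_re, dir_one_im]; linear_combination v / 4 * h3
  have e2 : ((u + v * dir 1 : ℂ) * (starRingEnd ℂ) (dir 2)).re = (v - u) / 2 := by
    have : dir 2 = dir 1 - 1 := by rw [← dir_one_sq, dir_eq_pow]; rfl
    rw [this, map_sub, mul_sub, Complex.sub_re, e1]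
    simp [dir_one_re]; ring
  have e : ∀ i, ((u + v * dir 1 : ℂ) * (starRingEnd ℂ) (dir (i + 3))).re =
      -((u + v * dir 1 : ℂ) * (starRingEnd ℂ) (dir i)).re := by
    intro i; rw [dir_add_three, map_neg, mul_neg, Complex.neg_re]
  have f3 := e 0
  have f4 := e 1
  have f5 := e 2
  rw [e0] at f3
  rw [e1] at f4
  rw [e2] at f5
  rw [Fin.forall_fin_succ, Fin.forall_fin_succ, Fin.forall_fin_succ, Fin.forall_fin_succ,
    Fin.forall_fin_succ, Fin.forall_fin_succ]
  simp only [IsEmpty.forall_iff, and_true]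
  change P _ ∧ P (((u + v * dir 1 : ℂ) * (starRingEnd ℂ) (dir 1)).re) ∧
    P (((u + v * dir 1 : ℂ) * (starRingEnd ℂ) (dir 2)).re) ∧
    P (((u + v * dir 1 : ℂ) * (starRingEnd ℂ) (dir (0 + 3))).re) ∧
    P (((u + v * dir 1 : ℂ) * (starRingEnd ℂ) (dir (1 + 3))).re) ∧
    P (((u + v * dir 1 : ℂ) * (starRingEnd ℂ) (dir (2 + 3))).re) ↔ _
  rw [e0, e1, e2, f3, f4, f5]

theorem exists_coords (f : Tile) (z : ℂ) :
    ∃ u v : ℝ, z = f.center + f.rot * (u + v * dir 1) := by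
  set w := (z - f.center) / f.rot with hw
  have h3 : (√3 : ℝ) ≠ 0 := by positivity
  refine ⟨w.re - w.im / √3, 2 * w.im / √3, ?_⟩
  have : ((w.re - w.im / √3 : ℝ) : ℂ) + ((2 * w.im / √3 : ℝ) : ℂ) * dir 1 = w := by
    apply Complex.ext
    · simp only [Complex.add_re, Complex.ofReal_re, Complex.mul_re, Complex.ofReal_im, dir_one_re]
      ring
    · simp only [Complex.add_im, Complex.ofReal_re, Complex.mul_im, Complex.ofReal_im, dir_one_im]
      field_simp
      ring
  rw [this, hw]
  field_simp [f.rot.coe_ne_zero]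
  ring

/-- Membership in the image, under the placement of a lattice tile, of a set cut out by conditions
on the projections to the edge normals. -/
theorem mem_image_place_siteTile (f : Tile) (s : ℤ × ℤ) (k : Fin 6) (u v : ℝ) (P : ℝ → Prop) :
    f.center + f.rot * (u + v * dir 1) ∈
        (siteTile f s k).place '' {z | ∀ i, P (z * (starRingEnd ℂ) (dir i)).re} ↔
      ∀ i, P ((((u - s.1 : ℝ) + (v - s.2 : ℝ) * dir 1 : ℂ) * (starRingEnd ℂ) (dir i)).re) := by
  have hk : dir k * (starRingEnd ℂ) (dir k) = 1 := by
    rw [← coe_unitRot, Complex.mul_conj, Circle.normSq_coe]; simp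
  have key : ∀ z, (siteTile f s k).place z = f.center + f.rot * (u + v * dir 1) ↔
      dir k * z = (u - s.1 : ℝ) + (v - s.2 : ℝ) * dir 1 := by
    intro z
    simp only [Tile.place, siteTile, Circle.coe_mul, coe_unitRot, siteVec]
    push_cast
    constructor
    · intro h
      apply mul_left_cancel₀ f.rot.coe_ne_zero
      linear_combination h
    · intro h
      linear_combination (f.rot : ℂ) * h
  have hswap : ∀ z i, dir k * z * (starRingEnd ℂ) (dir (k + i)) = z * (starRingEnd ℂ) (dir i) := by
    intro z i
    rw [dir_add, map_mul]
    linear_combination z * (starRingEnd ℂ) (dir i) * hk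
  constructor
  · rintro ⟨z, hz, hzz⟩ i
    rw [key] at hzz
    rw [← hzz]
    have := hz (i - k)
    rwa [← hswap, add_sub_cancel] at this
  · intro h
    refine ⟨(starRingEnd ℂ) (dir k) * ((u - s.1 : ℝ) + (v - s.2 : ℝ) * dir 1), fun i => ?_, ?_⟩
    · have := h (k + i)
      rw [← hswap, ← mul_assoc (dir k), hk, one_mul]
      exact this
    · rw [key, ← mul_assoc, hk, one_mul]

/-- The hexagons at the lattice sites cover the plane. -/
theorem exists_mem_support (f : Tile) (a : ℤ × ℤ → Fin 6) (z : ℂ) :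
    ∃ s, z ∈ (siteTile f s (a s)).support := by
  obtain ⟨u, v, rfl⟩ := exists_coords f z
  -- The nearest lattice point is one of the four corners of the unit cell around `(u, v)`.
  have key : ∃ s : ℤ × ℤ, ∀ i, (((u - s.1 : ℝ) + (v - s.2 : ℝ) * dir 1 : ℂ) *
      (starRingEnd ℂ) (dir i)).re ≤ 1 / 2 := by
    simp only [re_mul_conj_dir _ _ (fun t => t ≤ 1 / 2)]
    have hu := Int.floor_le u
    have hu' := Int.lt_floor_add_one u
    have hv := Int.floor_le v
    have hv' := Int.lt_floor_add_one v
    set x := ⌊u⌋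
    set y := ⌊v⌋
    by_cases h1 : 2 * (u - x) + (v - y) ≤ 1 ∧ (u - x) + 2 * (v - y) ≤ 1
    · refine ⟨(x, y), ?_⟩
      obtain ⟨h1, h2⟩ := h1
      refine ⟨?_, ?_, ?_, ?_, ?_, ?_⟩ <;> simp only <;> linarith
    by_cases h2 : 2 ≤ 2 * (u - x) + (v - y) ∧ 2 ≤ (u - x) + 2 * (v - y)
    · refine ⟨(x + 1, y + 1), ?_⟩
      obtain ⟨h1, h2⟩ := h2
      refine ⟨?_, ?_, ?_, ?_, ?_, ?_⟩ <;> push_cast <;> linarith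
    rw [not_and_or, not_le, not_le] at h1 h2
    rcases le_total (v - y) (u - x) with h3 | h3
    · have h4 : 1 ≤ 2 * (u - x) + (v - y) := by rcases h1 with h1 | h1 <;> linarith
      have h5 : (u - x) + 2 * (v - y) ≤ 2 := by rcases h2 with h2 | h2 <;> linarith
      refine ⟨(x + 1, y), ?_⟩
      refine ⟨?_, ?_, ?_, ?_, ?_, ?_⟩ <;> push_cast <;> linarith
    · have h4 : 1 ≤ (u - x) + 2 * (v - y) := by rcases h1 with h1 | h1 <;> linarith
      have h5 : 2 * (u - x) + (v - y) ≤ 2 := by rcases h2 with h2 | h2 <;> linarith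
      refine ⟨(x, y + 1), ?_⟩
      refine ⟨?_, ?_, ?_, ?_, ?_, ?_⟩ <;> push_cast <;> linarith
  obtain ⟨s, hs⟩ := key
  exact ⟨s, (mem_image_place_siteTile f s (a s) u v (fun t => t ≤ 1 / 2)).2 hs⟩

theorem isTiling_latticeTiling (f : Tile) (a : ℤ × ℤ → Fin 6) : IsTiling (latticeTiling f a) := by
  refine ⟨Set.eq_univ_of_forall fun z => ?_, ?_⟩
  · obtain ⟨s, hs⟩ := exists_mem_support f a z
    exact Set.mem_biUnion ⟨s, rfl⟩ hs
  · rintro _ ⟨s, rfl⟩ _ ⟨t, rfl⟩ hne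
    rw [Set.disjoint_left]
    intro z hs ht
    apply hne
    simp only [interior_support] at hs ht
    obtain ⟨u, v, rfl⟩ := exists_coords f z
    have hs' := (mem_image_place_siteTile f s (a s) u v (fun t => t < 1 / 2)).1 hs
    have ht' := (mem_image_place_siteTile f t (a t) u v (fun t => t < 1 / 2)).1 ht
    rw [re_mul_conj_dir _ _ (fun t => t < 1 / 2)] at hs' ht'
    obtain ⟨a1, a2, a3, a4, a5, a6⟩ := hs'
    obtain ⟨b1, b2, b3, b4, b5, b6⟩ := ht'
    have c1 : (2 * (s.1 - t.1) + (s.2 - t.2) : ℝ) < 2 := by linarith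
    have c2 : (-2 : ℝ) < 2 * (s.1 - t.1) + (s.2 - t.2) := by linarith
    have c3 : ((s.1 - t.1) + 2 * (s.2 - t.2) : ℝ) < 2 := by linarith
    have c4 : (-2 : ℝ) < (s.1 - t.1) + 2 * (s.2 - t.2) := by linarith
    have c5 : ((s.2 - t.2) - (s.1 - t.1) : ℝ) < 2 := by linarith
    have c6 : (-2 : ℝ) < (s.2 - t.2) - (s.1 - t.1) := by linarith
    norm_cast at c1 c2 c3 c4 c5 c6
    have : s = t := Prod.ext (by omega) (by omega)
    rw [this]

theorem IsTiling.eq_of_center_eq {T : Set Tile} (hT : IsTiling T) {p q : Tile} (hp : p ∈ T)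
    (hq : q ∈ T) (h : p.center = q.center) : p = q := by
  by_contra hne
  exact Set.disjoint_left.1 (hT.disjoint p hp q hq hne) (center_mem_interior_support p)
    (h ▸ center_mem_interior_support q)

/-- A tiling that satisfies R1 is edge-to-edge, so that its tiles occupy the sites of a lattice. -/
theorem exists_eq_latticeTiling {T : Set Tile} (hT : IsTiling T) (hR : SatisfiesR1 T) {f : Tile}
    (hf : f ∈ T) : ∃ a, T = latticeTiling f a ∧ a 0 = 0 := by
  have hnext : ∀ s d, (∃ k, siteTile f s k ∈ T) → ∃ k, siteTile f (s + step d) k ∈ T := by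
    rintro s d ⟨k, hk⟩
    obtain ⟨q, hq, j, hj⟩ := hR _ hk (d - k)
    obtain ⟨rfl, -⟩ := r1Joined_siteTile_iff.1 hj
    rw [add_sub_cancel] at hq
    exact ⟨_, hq⟩
  have hx : ∀ x : ℤ, ∃ k, siteTile f (x, 0) k ∈ T := by
    intro x
    induction x using Int.induction_on with
    | zero => exact ⟨0, by rw [show ((0 : ℤ), (0 : ℤ)) = 0 from rfl, siteTile_zero]; exact hf⟩
    | succ x ih => simpa [step] using hnext _ 0 ih
    | pred x ih => simpa [step, sub_eq_add_neg] using hnext _ 3 ih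
  have hall : ∀ s : ℤ × ℤ, ∃ k, siteTile f s k ∈ T := by
    rintro ⟨x, y⟩
    induction y using Int.induction_on with
    | zero => exact hx x
    | succ y ih => simpa [step] using hnext _ 1 ih
    | pred y ih => simpa [step, sub_eq_add_neg] using hnext _ 4 ih
  choose a ha using hall
  refine ⟨a, Set.Subset.antisymm ?_ ?_, ?_⟩
  · intro q hq
    obtain ⟨s, hs⟩ := exists_mem_support f a q.center
    have h1 := support_subset_closure_interior _ hs
    rw [mem_closure_iff] at h1
    obtain ⟨z, hz, hz'⟩ := h1 _ isOpen_interior (center_mem_interior_support q)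
    refine ⟨s, ?_⟩
    by_contra hne
    exact Set.disjoint_left.1 (hT.disjoint _ (ha s) q hq hne) hz' hz
  · rintro _ ⟨s, rfl⟩
    exact ha s
  · have h1 : siteTile f 0 (a 0) = siteTile f 0 0 :=
      hT.eq_of_center_eq (ha 0) (by rw [siteTile_zero]; exact hf) rfl
    exact (siteTile_injective h1).2

/-! ### Rule R2: ancestry along the R2-trees -/

theorem axis_add_three (d : Fin 6) : axis (d + 3) = axis d := by
  revert d; decide

theorem step_add_three (d : Fin 6) : step (d + 3) = -step d := by
  revert d; decide

theorem eq_or_eq_add_three {d e : Fin 6} (h : axis e = axis d) : e = d ∨ e = d + 3 := by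
  revert d e; decide

theorem sub_mem_treeEnds_iff {d k : Fin 6} :
    d - k ∈ treeEnds ↔ axis k = axis d ∨ axis k = axis d + 1 := by
  revert d k; decide

theorem treesMeet_siteTile_iff {f : Tile} {s t : ℤ × ℤ} {k l : Fin 6} :
    TreesMeet (siteTile f s k) (siteTile f t l) ↔ ∃ d, t = s + step d ∧
      (axis k = axis d ∨ axis k = axis d + 1) ∧ (axis l = axis d ∨ axis l = axis d + 1) := by
  constructor
  · rintro ⟨i, hi, j, hj, h⟩
    obtain ⟨rfl, rfl⟩ := siteTile_injective (sharesEdge_siteTile_iff.1 h)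
    refine ⟨k + i, rfl, sub_mem_treeEnds_iff.1 (by simpa using hi), ?_⟩
    rw [← axis_add_three (k + i)]
    exact sub_mem_treeEnds_iff.1 (by simpa using hj)
  · rintro ⟨d, rfl, h1, h2⟩
    refine ⟨d - k, sub_mem_treeEnds_iff.2 h1, d + 3 - l,
      sub_mem_treeEnds_iff.2 (by rwa [axis_add_three]), ?_⟩
    rw [sharesEdge_siteTile_iff]
    simp

theorem TreesMeet.symm {p q : Tile} (h : TreesMeet p q) : TreesMeet q p := by
  obtain ⟨i, hi, j, hj, h⟩ := h
  exact ⟨j, hj, i, hi, h.symm⟩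

/-- `z` is the parent of `x`: from `x` on, the sites in direction `d` have axis `d`, until the
site `z`, whose axis is `d` rotated by `π/3`. The R2-trees of all these sites are connected along
their line. -/
def Parent (a : ℤ × ℤ → Fin 6) (x z : ℤ × ℤ) : Prop :=
  ∃ (d : Fin 6) (t : ℕ), 0 < t ∧ z = x + (t : ℤ) • step d ∧
    (∀ i : ℕ, i < t → axis (a (x + (i : ℤ) • step d)) = axis d) ∧ axis (a z) = axis d + 1

theorem fin_three_add_one_ne (i : Fin 3) : i + 1 ≠ i := by
  revert i; decide

/-- A site has at most one parent: the two ends of its run have different axes. -/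
theorem Parent.unique (ha : Legal a) {x z z' : ℤ × ℤ} (h : Parent a x z) (h' : Parent a x z') :
    z = z' := by
  obtain ⟨d, t, ht, rfl, hrun, hz⟩ := h
  obtain ⟨e, u, hu, rfl, hrun', hz'⟩ := h'
  have hde : axis e = axis d := by
    rw [← hrun 0 ht, ← hrun' 0 hu]
    simp
  rcases eq_or_eq_add_three hde with rfl | rfl
  · rcases lt_trichotomy t u with h | rfl | h
    · rw [hrun' t h] at hz
      exact absurd hz.symm (fin_three_add_one_ne _)
    · rfl
    · rw [hrun u h] at hz'
      exact absurd hz'.symm (fin_three_add_one_ne _)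
  · exfalso
    have hline : ∀ i : ℤ, i • step (d + 3) = (-i) • step d := by
      intro i; rw [step_add_three]; simp
    have h1 := axis_ne_of_run (b := fun i : ℕ => a (x + ((i : ℤ) - u) • step d)) (d := d)
      (N := u + t) (fun i => by
        have := ha (x + ((i : ℤ) - u) • step d) d
        rw [show x + ((i : ℤ) - u) • step d + step d = x + (((i + 1 : ℕ) : ℤ) - u) • step d by
          push_cast; module] at this
        exact this) (by omega)
      (by
        rw [axis_add_three, hline] at hz'
        simp only [Nat.cast_zero, zero_sub, hz']
        exact fin_three_add_one_ne _)
      (fun i hi hi' => by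
        rcases lt_or_ge i u with hlt | hge
        · have := hrun' (u - i) (by omega)
          rw [hline, axis_add_three] at this
          rw [← this]
          congr 4
          omega
        · have := hrun (i - u) (by omega)
          rw [← this]
          congr 4
          omega)
      (by
        rw [show (((u + t : ℕ) : ℤ) - u) = t by push_cast; ring, hz]
        exact fin_three_add_one_ne _)
    apply h1
    rw [axis_add_three, hline] at hz'
    rw [show (((u + t : ℕ) : ℤ) - u) = t by push_cast; ring, hz]
    simp only [Nat.cast_zero, zero_sub, hz']

/-- In a connected tiling all sites without parent lie on one line: following parents leads from
every site to the bi-infinite line `y = 0`. -/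
theorem snd_eq_zero_of_not_parent {f : Tile} (ha : Legal a) (hR : SatisfiesR2 (latticeTiling f a))
    (hrow : ∀ x, axis (a (x, 0)) = 0) {x : ℤ × ℤ} (hx : ∀ z, ¬ Parent a x z) : x.2 = 0 := by
  have hrow' : ∀ s : ℤ × ℤ, s.2 = 0 → axis (a s) = 0 := by
    rintro ⟨u, v⟩ rfl
    exact hrow u
  have hstep : ∀ d : Fin 6, axis d = 0 → (step d).2 = 0 := by decide
  let O : ℤ × ℤ → Prop := fun s => ∃ r : ℤ × ℤ, r.2 = 0 ∧ Relation.ReflTransGen (Parent a) s r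
  have hadj : ∀ s t, TreesMeet (siteTile f s (a s)) (siteTile f t (a t)) → O s → O t := by
    intro s t hst hO
    obtain ⟨d, rfl, h1, h2⟩ := treesMeet_siteTile_iff.1 hst
    obtain ⟨r, hr, hsr⟩ := hO
    rcases h1 with h1 | h1 <;> rcases h2 with h2 | h2
    · rcases Relation.ReflTransGen.cases_head hsr with rfl | ⟨z, hz, hzr⟩
      · refine ⟨s + step d, ?_, .refl⟩
        rw [Prod.snd_add, hr, hstep d (h1 ▸ hrow' _ hr), add_zero]
      · refine ⟨r, hr, .head ?_ hzr⟩
        obtain ⟨e, u, hu, rfl, hrun, hz⟩ := hz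
        have he : axis e = axis d := by rw [← h1, ← hrun 0 hu]; simp
        rcases eq_or_eq_add_three he with rfl | rfl
        · have hu1 : u ≠ 1 := by
            rintro rfl
            rw [Nat.cast_one, one_smul, h2] at hz
            exact fin_three_add_one_ne _ hz.symm
          refine ⟨e, u - 1, by omega, ?_, fun i hi => ?_, hz⟩
          · rw [Nat.cast_sub hu]; push_cast; module
          · rw [← hrun (i + 1) (by omega)]
            congr 2
            push_cast; module
        · refine ⟨d + 3, u + 1, by omega, ?_, fun i hi => ?_, hz⟩
          · rw [step_add_three]; push_cast; module
          · rcases i with _ | i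
            · simpa [axis_add_three] using h2
            · rw [← hrun i (by omega), step_add_three]
              congr 2
              push_cast; module
    · have hp : Parent a s (s + step d) := ⟨d, 1, one_pos, by simp, fun i hi => by
        obtain rfl : i = 0 := by omega
        simpa using h1, h2⟩
      rcases Relation.ReflTransGen.cases_head hsr with rfl | ⟨z, hz, hzr⟩
      · have e1 := hrow' _ hr
        have e2 : (s + step d).2 = 0 := by
          rw [Prod.snd_add, hr, hstep d (h1 ▸ e1), add_zero]
        have e3 := hrow' _ e2
        rw [h2, ← h1, e1] at e3
        exact absurd e3 (by decide)
      · rw [hp.unique ha hz]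
        exact ⟨r, hr, hzr⟩
    · refine ⟨r, hr, .head ⟨d + 3, 1, one_pos, ?_, fun i hi => ?_, ?_⟩ hsr⟩
      · rw [step_add_three]; push_cast; module
      · obtain rfl : i = 0 := by omega
        simpa [axis_add_three] using h2
      · rw [axis_add_three]; exact h1
    · have hne := fin_three_add_one_ne (axis d)
      have h3 := ha s d
      rw [osign_opposite_of_axis_ne (by rwa [h2])] at h3
      exact absurd (h1.trans h2.symm) (osign_ne_of_axis_ne (by rwa [h1]) (by rwa [h2]) h3)
  have hreach : ∀ p, Relation.ReflTransGen (fun p q => p ∈ latticeTiling f a ∧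
      q ∈ latticeTiling f a ∧ TreesMeet p q) (siteTile f 0 (a 0)) p →
      ∃ s, p = siteTile f s (a s) ∧ O s := by
    intro p hp
    induction hp with
    | refl => exact ⟨0, rfl, 0, rfl, .refl⟩
    | tail _ hbc ih =>
      obtain ⟨s, rfl, hs⟩ := ih
      obtain ⟨-, ⟨t, rfl⟩, hm⟩ := hbc
      exact ⟨t, rfl, hadj s t hm hs⟩
  obtain ⟨s, hs, r, hr, hsr⟩ := hreach _ (hR _ ⟨0, rfl⟩ _ ⟨x, rfl⟩)
  obtain ⟨rfl, -⟩ := siteTile_injective hs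
  rcases Relation.ReflTransGen.cases_head hsr with rfl | ⟨z, hz, -⟩
  · exact hr
  · exact absurd hz (hx z)

/-- In a connected tiling with a bi-infinite line, no corner continues, on the side where the R2-tree
is cut off from it, into an infinite ray: the sites of the ray would have no parent. -/
theorem not_infinite_ray {f : Tile} (ha : Legal a) (hR : SatisfiesR2 (latticeTiling f a))
    (hrow : ∀ x, axis (a (x, 0)) = 0) {s : ℤ × ℤ} {d : Fin 6} (hs : axis (a s) + 1 = axis d)
    (hray : ∀ t : ℕ, 0 < t → axis (a (s + (t : ℤ) • step d)) = axis d) : False := by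
  have hrow' : ∀ s : ℤ × ℤ, s.2 = 0 → axis (a s) = 0 := by
    rintro ⟨u, v⟩ rfl
    exact hrow u
  have hstep : ∀ d : Fin 6, axis d = 0 → (step d).2 = 0 := by decide
  have hsd : axis (a s) ≠ axis d := by
    rw [← hs]; exact (fin_three_add_one_ne _).symm
  have h1 : axis (a (s + step d)) = axis d := by simpa using hray 1 one_pos
  have h0 : (s + step d).2 = 0 := by
    refine snd_eq_zero_of_not_parent ha hR hrow fun z hz => ?_
    obtain ⟨e, u, hu, rfl, hrun, hz⟩ := hz
    have he : axis e = axis d := by rw [← h1, ← hrun 0 hu]; simp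
    rcases eq_or_eq_add_three he with rfl | rfl
    · have := hray (u + 1) (by omega)
      rw [show s + step e + (u : ℤ) • step e = s + ((u + 1 : ℕ) : ℤ) • step e by
        push_cast; module, this] at hz
      exact fin_three_add_one_ne _ hz.symm
    · rcases (show u = 1 ∨ 1 < u by omega) with rfl | hu1
      · rw [step_add_three, show s + step d + ((1 : ℕ) : ℤ) • -step d = s by push_cast; module,
          axis_add_three, ← hs] at hz
        revert hz
        generalize axis (a s) = q
        revert q; decide
      · have := hrun 1 hu1
        rw [step_add_three, show s + step d + ((1 : ℕ) : ℤ) • -step d = s by push_cast; module,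
          axis_add_three] at this
        exact hsd this
  have hd : axis d = 0 := by rw [← h1]; exact hrow' _ h0
  rw [Prod.snd_add, hstep d hd, add_zero] at h0
  exact hsd (by rw [hd]; exact hrow' s h0)

/-! ### Walks along R1-curves -/

theorem mate_mate (i : Fin 6) : mate (mate i) = i := by
  revert i; decide

instance decidablePredIsStraight : DecidablePred IsStraight := fun i =>
  inferInstanceAs (Decidable (i = 0 ∨ i = 3))

theorem isStraight_mate_iff {i : Fin 6} : IsStraight (mate i) ↔ IsStraight i := by
  revert i; decide

theorem isStraight_iff_axis {d k : Fin 6} : IsStraight (d + 3 - k) ↔ axis k = axis d := by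
  revert d k; decide

theorem add_mate_of_isStraight {d k : Fin 6} (h : IsStraight (d + 3 - k)) :
    k + mate (d + 3 - k) = d := by
  revert d k; decide

theorem IsR1Walk.reverse {T : Set Tile} {γ : ℤ → Tile × Fin 6} (h : IsR1Walk T γ) :
    IsR1Walk T fun n => ((γ (-n)).1, mate (γ (-n)).2) := by
  intro n
  refine ⟨(h _).1, ?_⟩
  have := (h (-(n + 1))).2.symm
  simp only [mate_mate]
  rwa [show -(n + 1) + 1 = -n by ring] at this

theorem IsR1Line.reverse {T : Set Tile} {γ : ℤ → Tile × Fin 6} (h : IsR1Line T γ) :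
    IsR1Line T fun n => ((γ (-n)).1, mate (γ (-n)).2) :=
  ⟨h.1.reverse, fun _ => isStraight_mate_iff.2 (h.2 _)⟩

theorem IsR1Walk.next {f : Tile} {γ : ℤ → Tile × Fin 6} (h : IsR1Walk (latticeTiling f a) γ)
    {n : ℤ} {s : ℤ × ℤ} {i d : Fin 6} (hn : γ n = (siteTile f s (a s), i)) (hd : a s + mate i = d) :
    γ (n + 1) = (siteTile f (s + step d) (a (s + step d)), d + 3 - a (s + step d)) := by
  have h1 := (h n).2
  have h2 := (h (n + 1)).1
  rw [hn, r1Joined_siteTile_iff, hd] at h1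
  rw [h1.1, siteTile_mem_latticeTiling] at h2
  refine Prod.ext (h1.1.trans (by rw [h2])) ?_
  rw [← h2]; simp

theorem IsR1Walk.ray {f : Tile} {γ : ℤ → Tile × Fin 6} (h : IsR1Walk (latticeTiling f a) γ)
    {s : ℤ × ℤ} {i d : Fin 6} (h0 : γ 0 = (siteTile f s (a s), i)) (hd : a s + mate i = d) {N : ℕ}
    (hst : ∀ n : ℕ, 0 < n → n < N → IsStraight (γ n).2) (n : ℕ) (hn : 0 < n) (hN : n ≤ N) :
    γ n = (siteTile f (s + (n : ℤ) • step d) (a (s + (n : ℤ) • step d)),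
      d + 3 - a (s + (n : ℤ) • step d)) := by
  induction n, hn using Nat.le_induction with
  | base => simpa using h.next h0 hd
  | succ n hn ih =>
    have h1 := ih (by omega)
    have h2 := hst n hn (by omega)
    rw [h1] at h2
    have h3 := h.next h1 (add_mate_of_isStraight h2)
    rw [show s + (n : ℤ) • step d + step d = s + ((n + 1 : ℕ) : ℤ) • step d by
      push_cast; module] at h3
    exact_mod_cast h3

theorem isR1Walk_of_path {f : Tile} (ha : Legal a) {P : ℤ → ℤ × ℤ} {I O : ℤ → Fin 6}
    (hP : ∀ n, P (n + 1) = P n + step (O n)) (hI : ∀ n, I (n + 1) = O n)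
    (hturn : ∀ n, a (P n) + mate (I n + 3 - a (P n)) = O n) :
    IsR1Walk (latticeTiling f a) fun n => (siteTile f (P n) (a (P n)), I n + 3 - a (P n)) := by
  intro n
  refine ⟨⟨P n, rfl⟩, ?_⟩
  beta_reduce
  rw [r1Joined_siteTile_iff, hturn, hI, ← hP]
  refine ⟨by simp, ?_⟩
  rw [hP, show mate (I n + 3 - a (P n)) = O n - a (P n) by rw [← hturn n]; simp]
  exact ha (P n) (O n)

/-- A tiling with a bi-infinite line, seen from a tile of the line: the line is the row `y = 0`. -/
theorem exists_latticeTiling_of_line {T : Set Tile} (hT : T ∈ classC) {γ : ℤ → Tile × Fin 6}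
    (hγ : IsR1Line T γ) {p : Tile} (h0 : γ 0 = (p, 3)) :
    ∃ a, T = latticeTiling p a ∧ Legal a ∧ (∀ x, a (x, 0) = 0) ∧
      ∀ n : ℤ, γ n = (siteTile p (n, 0) 0, 3) := by
  obtain ⟨hT1, hT2, hT3⟩ := hT
  have hp : p ∈ T := by simpa [h0] using (hγ.1 0).1
  obtain ⟨a, rfl, ha0⟩ := exists_eq_latticeTiling hT1 hT2 hp
  have ha := satisfiesR1_latticeTiling_iff.1 hT2
  have key : ∀ n : ℤ, a (n, 0) = 0 ∧ γ n = (siteTile p (n, 0) 0, 3) := by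
    intro n
    induction n using Int.induction_on with
    | zero => exact ⟨ha0, by rw [h0]; congr 1; exact (siteTile_zero p).symm⟩
    | succ n ih =>
      obtain ⟨h1, h2⟩ := ih
      have h3 := hγ.1.next (n := n) (s := (n, 0)) (i := 3) (d := 0) (by rw [h2, h1])
        (by rw [h1]; rfl)
      have h4 := hγ.2 (n + 1)
      have h5 := ha.right n 0
      simp only [step, Matrix.cons_val_zero, Prod.mk_add_mk, add_zero] at h3
      rw [h3] at h4 ⊢
      rw [h1] at h5
      have : a ((n : ℤ) + 1, 0) = 0 := by
        dsimp only at h4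
        revert h4 h5
        generalize a ((n : ℤ) + 1, 0) = q
        revert q; decide
      rw [this]
      exact ⟨rfl, rfl⟩
    | pred n ih =>
      obtain ⟨h1, h2⟩ := ih
      have h3 := hγ.1.reverse.next (n := n) (s := (-n, 0)) (i := 0) (d := 3)
        (by rw [h2, h1]; rfl) (by rw [h1]; rfl)
      have h4 := hγ.2 (-(n + 1))
      have h5 := ha.right (-n - 1) 0
      have h6 : ((-(n : ℤ), (0 : ℤ)) : ℤ × ℤ) + step 3 = (-(n : ℤ) - 1, 0) := by
        simp [step, sub_eq_add_neg]
      rw [h6] at h3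
      rw [Prod.ext_iff] at h3
      obtain ⟨h7, h8⟩ := h3
      simp only at h7 h8
      rw [sub_add_cancel, h1] at h5
      rw [show -((n : ℤ) + 1) = -n - 1 by ring] at h4 h7 h8
      rw [← isStraight_mate_iff, h8] at h4
      have h9 : a (-(n : ℤ) - 1, 0) = 0 := by
        revert h4 h5
        generalize a (-(n : ℤ) - 1, 0) = q
        revert q; decide
      rw [h9] at h7 h8
      refine ⟨h9, Prod.ext h7 ?_⟩
      have := congrArg mate h8
      rw [mate_mate] at this
      exact this
  exact ⟨a, rfl, ha, fun x => (key x).1, fun n => (key n).2⟩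

theorem isR1Line_row {f : Tile} (hrow : ∀ x, a (x, 0) = 0) :
    IsR1Line (latticeTiling f a) fun n : ℤ => (siteTile f (n, 0) 0, 3) := by
  refine ⟨fun n => ⟨siteTile_mem_latticeTiling.2 (hrow n).symm, ?_⟩, fun n => Or.inr rfl⟩
  dsimp only
  rw [r1Joined_siteTile_iff]
  refine ⟨?_, by decide⟩
  simp [mate, step]

/-! ### R1-triangles along a line -/

theorem emod_add_one {t M : ℤ} (hM : 0 < M) :
    (t + 1) % M = if t % M + 1 = M then 0 else t % M + 1 := by
  rw [← Int.emod_add_emod]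
  have h1 := Int.emod_nonneg t hM.ne'
  have h2 := Int.emod_lt_of_pos t hM
  split_ifs with h3
  · rw [h3, Int.emod_self]
  · exact Int.emod_eq_of_lt (by omega) (by omega)

theorem add_mate_of_axis_eq {d k : Fin 6} (h : axis k = axis d) : k + mate (d + 3 - k) = d := by
  revert d k; decide

theorem add_mate_right {d k : Fin 6} (h : axis k + 1 = axis d) :
    k + mate (d + 3 - k) = d - 2 := by
  revert d k; decide

/-- The triangle with a corner on the line `y = 0` at a position of level `m` has the corners
`(n, 0)`, `(n - 2 ^ m, 2 ^ m)` and `(n, 2 ^ m)`. -/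
theorem isCornerOfTriangle_of_isLevelRow {f : Tile} (ha : Legal a) (hh : IsInterlaced h)
    (hrow : ∀ y, 0 ≤ y → IsLevelRow a h y) (n : ℤ) :
    IsCornerOfTriangle (latticeTiling f a) (siteTile f (n, 0) (a (n, 0))) (1 - a (n, 0))
      (2 ^ h n - 1) := by
  set N : ℤ := 2 ^ h n with hN
  have hN0 : 0 < N := by positivity
  have hM : 0 < 3 * N := by positivity
  have hax0 : axis (a (n, 0)) = 0 := by
    rw [(hrow 0 le_rfl n).1, add_zero, levelAxis_eq_zero]
  have hL : ∀ t : ℤ, 0 < t → t < N → axis (a (n - t, t)) = 2 := by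
    intro t h1 h2
    rw [(hrow t h1.le _).1, sub_add_cancel, (hh.levelAxis_column' n h1).1 h2]
  have hL' : axis (a (n - N, N)) = 1 := by
    rw [(hrow N hN0.le _).1, sub_add_cancel, (hh.levelAxis_column' n hN0).2 rfl]
  have hT : ∀ t : ℤ, 0 < t → t < N → axis (a (n - t, N)) = 0 := by
    intro t h1 h2
    rw [(hrow N hN0.le _).1, levelAxis_eq_zero, hh.eq_iff, hN]
    apply pow_dvd_pow
    by_contra! hlt
    have h3 := hh.dvd_of_le (h n) (x := n - t) (y := n) (by omega) le_rfl
    rw [sub_sub_cancel] at h3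
    exact (Int.le_of_dvd h1 h3).not_gt h2
  have hR : ∀ t : ℤ, 0 < t → t < N → axis (a (n, t)) = 1 := by
    intro t h1 h2
    rw [(hrow t h1.le _).1, (hh.levelAxis_column n h1).1 h2]
  have hR' : axis (a (n, N)) = 2 := by
    rw [(hrow N hN0.le _).1, (hh.levelAxis_column n hN0).2 rfl]
  let Q : ℤ → ℤ × ℤ := fun r =>
    if r < N then (n - r, r) else if r < 2 * N then (n - (2 * N - r), N) else (n, 3 * N - r)
  let I : ℤ → Fin 6 := fun r => if r = 0 then 4 else if r ≤ N then 2 else if r ≤ 2 * N then 0 else 4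
  let O : ℤ → Fin 6 := fun r => if r < N then 2 else if r < 2 * N then 0 else 4
  -- The site `Q r`, entered in direction `I r`, is left in direction `O r`.
  have hcases : ∀ r, 0 ≤ r → r < 3 * N → (axis (a (Q r)) = axis (I r) ∧ O r = I r ∧ ¬ N ∣ r) ∨
      (axis (a (Q r)) + 1 = axis (I r) ∧ O r = I r - 2 ∧ N ∣ r) := by
    intro r h0 h3
    have hnd : ∀ c : ℤ, c * N < r → r < (c + 1) * N → ¬ N ∣ r := by
      rintro c h1 h2 ⟨e, rfl⟩
      have e1 : c < e := by
        by_contra! hle; nlinarith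
      have e2 : e < c + 1 := by
        by_contra! hle; nlinarith
      omega
    simp only [Q, I, O]
    rcases h0.eq_or_lt with rfl | h0
    · right
      simp only [hN0, if_true, sub_zero, hax0, dvd_zero]
      decide
    rcases lt_trichotomy r N with h1 | rfl | h1
    · left
      simp only [h1, h0.ne', h1.le, if_true, if_false, hL r h0 h1]
      exact ⟨rfl, trivial, hnd 0 (by omega) (by omega)⟩
    · right
      rw [if_neg (lt_irrefl _), if_pos (show N < 2 * N by omega), if_neg h0.ne', if_pos le_rfl,
        if_neg (lt_irrefl _), if_pos (show N < 2 * N by omega),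
        show n - (2 * N - N) = n - N by ring, hL']
      exact ⟨rfl, rfl, dvd_rfl⟩
    rw [if_neg h1.not_gt, if_neg h0.ne', if_neg h1.not_ge, if_neg h1.not_gt]
    rcases lt_trichotomy r (2 * N) with h2 | rfl | h2
    · left
      simp only [h2, h2.le, if_true]
      rw [hT _ (by omega) (by omega)]
      exact ⟨rfl, trivial, hnd 1 (by omega) (by omega)⟩
    · right
      rw [if_neg (lt_irrefl _), if_pos le_rfl, if_neg (lt_irrefl _),
        show 3 * N - 2 * N = N by ring, hR']
      exact ⟨rfl, rfl, ⟨2, by ring⟩⟩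
    · left
      rw [if_neg h2.not_gt, if_neg h2.not_ge, if_neg h2.not_gt, hR _ (by omega) (by omega)]
      exact ⟨rfl, rfl, hnd 2 (by omega) (by omega)⟩
  have hmod : ∀ t : ℤ, 0 ≤ t % (3 * N) ∧ t % (3 * N) < 3 * N := fun t =>
    ⟨Int.emod_nonneg t hM.ne', Int.emod_lt_of_pos t hM⟩
  have hdvd : ∀ t : ℤ, N ∣ t % (3 * N) ↔ N ∣ t := fun t => by
    rw [Int.emod_def]
    exact dvd_sub_left (((dvd_refl N).mul_left 3).mul_right _)
  have hLN : (((2 ^ h n - 1 : ℕ) : ℤ) + 1) = N := by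
    rw [Nat.cast_sub Nat.one_le_two_pow, hN]; push_cast; ring
  refine ⟨fun t => (siteTile f (Q (t % (3 * N))) (a (Q (t % (3 * N)))),
    I (t % (3 * N)) + 3 - a (Q (t % (3 * N)))), ⟨?_, ?_, ?_⟩, ?_⟩
  · refine isR1Walk_of_path ha (P := fun t => Q (t % (3 * N))) (I := fun t => I (t % (3 * N)))
      (O := fun t => O (t % (3 * N))) (fun t => ?_) (fun t => ?_) (fun t => ?_)
    · obtain ⟨h0, h3⟩ := hmod t
      rw [emod_add_one hM]
      generalize t % (3 * N) = r at h0 h3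
      simp only [Q, O]
      split_ifs <;> simp only [step, Matrix.cons_val] <;> ext <;>
        simp only [Prod.mk_add_mk] <;> omega
    · obtain ⟨h0, h3⟩ := hmod t
      rw [emod_add_one hM]
      generalize t % (3 * N) = r at h0 h3
      simp only [I, O]
      split_ifs <;> first | rfl | (exfalso; omega)
    · rcases hcases _ (hmod t).1 (hmod t).2 with ⟨h1, h2, -⟩ | ⟨h1, h2, -⟩
      · rw [h2, add_mate_of_axis_eq h1]
      · rw [h2, add_mate_right h1]
  · intro t
    beta_reduce
    rw [hLN, Int.add_emod_right]
  · intro t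
    simp only
    rw [hLN, isStraight_iff_axis]
    rcases hcases _ (hmod t).1 (hmod t).2 with ⟨h1, -, h3⟩ | ⟨h1, -, h3⟩
    · simp [h1, ← hdvd t, h3]
    · rw [← h1, ← hdvd t]
      simp only [h3, iff_true]
      exact (fin_three_add_one_ne _).symm
  · simp only [Int.zero_emod, Q, I, hN0, if_true, sub_zero]
    congr 1

/-- The length of the triangle with a corner at a position of the line determines its level. -/
theorem eq_of_isCornerOfTriangle {f : Tile} (hh : IsInterlaced h)
    (hrow : ∀ y, 0 ≤ y → IsLevelRow a h y) {n : ℤ} {m : ℕ}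
    (hc : IsCornerOfTriangle (latticeTiling f a) (siteTile f (n, 0) (a (n, 0))) (1 - a (n, 0))
      (2 ^ m - 1)) : m = h n := by
  obtain ⟨τ, ⟨hw, -, hst⟩, h0⟩ := hc
  have hLN : (((2 ^ m - 1 : ℕ) : ℤ) + 1) = ((2 ^ m : ℕ) : ℤ) := by
    rw [Nat.cast_sub Nat.one_le_two_pow]; push_cast; ring
  rw [hLN] at hst
  have hax0 : axis (a (n, 0)) = 0 := by
    rw [(hrow 0 le_rfl n).1, add_zero, levelAxis_eq_zero]
  have hd : a (n, 0) + mate (1 - a (n, 0)) = 2 := by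
    revert hax0
    generalize a (n, 0) = q
    revert q; decide
  have hstraight : ∀ t : ℕ, 0 < t → t < 2 ^ m → IsStraight (τ t).2 := by
    intro t h1 h2
    by_contra hns
    have := Int.le_of_dvd (by omega) ((hst t).1 hns)
    omega
  have hray := hw.ray h0 hd hstraight
  have hsite : ∀ t : ℤ, ((n, 0) : ℤ × ℤ) + t • step 2 = (n - t, t) := by
    intro t; simp [step, sub_eq_add_neg]
  have hax : ∀ t : ℕ, 0 < t → t ≤ 2 ^ m →
      (IsStraight (τ t).2 ↔ levelAxis (h (n - t)) (h n) = 2) := by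
    intro t h1 h2
    rw [hray t h1 h2, isStraight_iff_axis, hsite, (hrow t (by omega) _).1, sub_add_cancel]
    rfl
  have hlast := (hst ((2 ^ m : ℕ) : ℤ)).2 dvd_rfl
  rw [hax _ (by positivity) le_rfl] at hlast
  by_contra hne
  rcases lt_or_gt_of_ne hne with hlt | hlt
  · refine hlast ((hh.levelAxis_column' n (by positivity)).1 ?_)
    push_cast
    exact pow_lt_pow_right₀ (by norm_num) hlt
  · have hlt' : (2 : ℕ) ^ h n < 2 ^ m := Nat.pow_lt_pow_right (by norm_num) hlt
    have h1 := (hax (2 ^ h n) (by positivity) hlt'.le).1 (hstraight _ (by positivity) hlt')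
    rw [(hh.levelAxis_column' n (by positivity)).2 (by push_cast; rfl)] at h1
    exact absurd h1 (by decide)

/-! ### Connectedness of the R2-trees above a line -/

/-- The relation of R2: the trees of `p` and `q` are linked through tiles of `T`. -/
def Linked (T : Set Tile) : Tile → Tile → Prop :=
  Relation.ReflTransGen fun p q => p ∈ T ∧ q ∈ T ∧ TreesMeet p q

theorem Linked.symm {T : Set Tile} {p q : Tile} (h : Linked T p q) : Linked T q p :=
  have : Std.Symm fun p q : Tile => p ∈ T ∧ q ∈ T ∧ TreesMeet p q :=
    ⟨fun _ _ ⟨h1, h2, h3⟩ => ⟨h2, h1, h3.symm⟩⟩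
  Relation.ReflTransGen.stdSymm.symm _ _ h

theorem Linked.trans {T : Set Tile} {p q r : Tile} (h : Linked T p q) (h' : Linked T q r) :
    Linked T p r :=
  Relation.ReflTransGen.trans h h'

/-- The tile of `latticeTiling f a` at a site. -/
noncomputable abbrev tileAt (f : Tile) (a : ℤ × ℤ → Fin 6) (s : ℤ × ℤ) : Tile :=
  siteTile f s (a s)

/-- The trees along a run of sites of axis `d` are linked, also to the site after its end if the
axis of this is `d` rotated by `π/3`. -/
theorem linked_run (f : Tile) {s : ℤ × ℤ} (d : Fin 6) (t : ℕ)
    (hrun : ∀ i : ℕ, i < t → axis (a (s + (i : ℤ) • step d)) = axis d)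
    (hend : axis (a (s + (t : ℤ) • step d)) = axis d ∨
      axis (a (s + (t : ℤ) • step d)) = axis d + 1) :
    Linked (latticeTiling f a) (tileAt f a s) (tileAt f a (s + (t : ℤ) • step d)) := by
  induction t with
  | zero => rw [Nat.cast_zero, zero_smul, add_zero]; exact .refl
  | succ t ih =>
    have h1 := hrun t (by omega)
    refine .tail (ih (fun i hi => hrun i (by omega)) (Or.inl h1)) ⟨⟨_, rfl⟩, ⟨_, rfl⟩, ?_⟩
    rw [treesMeet_siteTile_iff]
    exact ⟨d, by push_cast; module, Or.inl h1, hend⟩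

theorem IsInterlaced.levelAxis_eq_iff_not_dvd {x y : ℤ} (hh : IsInterlaced h) :
    (levelAxis (h x) (h (x + y)) = 1 ↔ ¬ (2 : ℤ) ^ h x ∣ y) ∧
    (levelAxis (h x) (h (x + y)) = 2 ↔ ¬ (2 : ℤ) ^ h (x + y) ∣ y) := by
  rw [levelAxis_eq_one, levelAxis_eq_two, ← hh.le_iff, ← hh.le_iff', not_le, not_le]
  exact ⟨Iff.rfl, Iff.rfl⟩

/-- Between two consecutive multiples of `2 ^ k`, one has even and one has odd quotient. -/
theorem exists_multiple {k : ℕ} {y : ℤ} (hy : ¬ (2 : ℤ) ^ k ∣ y) (r : ℤ) :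
    ∃ c : ℤ, (2 : ℤ) ∣ c - r ∧ ((c * 2 ^ k < y ∧ y < c * 2 ^ k + 2 ^ k) ∨
      (y < c * 2 ^ k ∧ c * 2 ^ k - 2 ^ k < y)) := by
  have hp : (0 : ℤ) < 2 ^ k := by positivity
  have h1 := Int.emod_add_mul_ediv y (2 ^ k)
  have h2 := Int.emod_lt_of_pos y hp
  have h3 : 0 < y % 2 ^ k :=
    (Int.emod_nonneg y hp.ne').lt_of_ne fun e => hy (Int.dvd_of_emod_eq_zero e.symm)
  set q := y / 2 ^ k
  have h4 : (2 : ℤ) ^ k * q = q * 2 ^ k := mul_comm _ _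
  rcases Int.emod_two_eq_zero_or_one (q - r) with h | h
  · exact ⟨q, by omega, Or.inl ⟨by omega, by omega⟩⟩
  · refine ⟨q + 1, by omega, Or.inr ?_⟩
    rw [add_mul, one_mul]
    exact ⟨by omega, by omega⟩

/-- No multiple of `p` lies strictly between two consecutive multiples of `p`. -/
theorem not_dvd_of_between {p c z : ℤ} (h1 : c * p < z) (h2 : z < c * p + p) : ¬ p ∣ z := by
  rintro ⟨e, rfl⟩
  have hp : 0 < p := by linarith
  have e1 : c < e := by
    by_contra! hle; nlinarith
  have e2 : e < c + 1 := by
    by_contra! hle; nlinarith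
  omega

section reach

variable (f : Tile)

/-- A run along a line with parameter `z ∈ ℤ`, from the position `y` to a multiple `c * p` of `p`
next to it, when the positions that are no multiples of `p` have axis `d`. -/
theorem linked_of_between {s : ℤ × ℤ} (d : Fin 6) {p c y : ℤ}
    (hc : (c * p < y ∧ y < c * p + p) ∨ (y < c * p ∧ c * p - p < y))
    (hrun : ∀ z, min (c * p) y ≤ z → ¬ p ∣ z → axis (a (s + z • step d)) = axis d)
    (hend : axis (a (s + (c * p) • step d)) = axis d + 1) :
    Linked (latticeTiling f a) (tileAt f a (s + y • step d))
      (tileAt f a (s + (c * p) • step d)) := by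
  rcases hc with ⟨h1, h2⟩ | ⟨h1, h2⟩
  · have key := linked_run f (a := a) (s := s + y • step d) (d + 3) (y - c * p).toNat ?_ ?_
    · have e : s + y • step d + ((y - c * p).toNat : ℤ) • step (d + 3) = s + (c * p) • step d := by
        rw [Int.toNat_of_nonneg (by omega), step_add_three]; module
      rwa [e] at key
    · intro i hi
      rw [step_add_three, axis_add_three,
        show s + y • step d + (i : ℤ) • -step d = s + (y - i) • step d by module]
      exact hrun _ (by omega) (not_dvd_of_between (c := c) (by omega) (by omega))
    · right
      rw [Int.toNat_of_nonneg (by omega), step_add_three, axis_add_three, ← hend,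
        show s + y • step d + (y - c * p) • -step d = s + (c * p) • step d by module]
  · have key := linked_run f (a := a) (s := s + y • step d) d (c * p - y).toNat ?_ ?_
    · have e : s + y • step d + ((c * p - y).toNat : ℤ) • step d = s + (c * p) • step d := by
        rw [Int.toNat_of_nonneg (by omega)]; module
      rwa [e] at key
    · intro i hi
      rw [show s + y • step d + (i : ℤ) • step d = s + (y + i) • step d by module]
      refine hrun _ (by omega) (not_dvd_of_between (c := c - 1) ?_ ?_)
      · rw [sub_mul, one_mul]; omega
      · rw [sub_mul, one_mul]; omega
    · right
      rw [Int.toNat_of_nonneg (by omega), ← hend,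
        show s + y • step d + (c * p - y) • step d = s + (c * p) • step d by module]

/-- From a site of axis `1` the tree leads along its column to the next odd multiple of `2 ^ k`,
where `k` is the level of the foot of the column. -/
theorem linked_of_axis_one (hh : IsInterlaced h) (hrow : ∀ y, 0 ≤ y → IsLevelRow a h y)
    {x y : ℤ} (hy : 0 ≤ y) (hlt : h (x + y) < h x) :
    ∃ c : ℤ, ((c * 2 ^ h x < y ∧ y < c * 2 ^ h x + 2 ^ h x) ∨
      (y < c * 2 ^ h x ∧ c * 2 ^ h x - 2 ^ h x < y)) ∧ 0 < c ∧
      h x < h (x + c * 2 ^ h x) ∧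
      Linked (latticeTiling f a) (tileAt f a (x, y)) (tileAt f a (x, c * 2 ^ h x)) := by
  have hp : (0 : ℤ) < 2 ^ h x := by positivity
  have hnd : ¬ (2 : ℤ) ^ h x ∣ y := by rwa [← hh.le_iff, not_le]
  obtain ⟨c, hc2, hc⟩ := exists_multiple hnd 1
  have hc0 : 0 < c := by
    by_contra! hle
    have : c ≤ -1 := by omega
    have : c * 2 ^ h x ≤ -1 * 2 ^ h x := mul_le_mul_of_nonneg_right this hp.le
    omega
  have hlt' : h x < h (x + c * 2 ^ h x) := by
    rw [lt_iff_le_and_ne, hh.le_iff, Ne, hh.eq_iff, pow_succ, mul_comm c, mul_dvd_mul_iff_left hp.ne']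
    exact ⟨dvd_mul_right _ _, by omega⟩
  have hnn : 0 ≤ c * 2 ^ h x := by positivity
  have hsite : ∀ z : ℤ, ((x, 0) : ℤ × ℤ) + z • step 1 = (x, z) := by intro z; simp [step]
  refine ⟨c, hc, hc0, hlt', ?_⟩
  have := linked_of_between f (a := a) (s := (x, 0)) 1 hc (fun z hz hz' => ?_) ?_
  · rwa [hsite, hsite] at this
  · have hz0 : 0 ≤ z := (le_min hnn hy).trans hz
    rw [hsite, (hrow z hz0 x).1, (hh.levelAxis_eq_iff_not_dvd (x := x)).1.2 hz']
    rfl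
  · rw [hsite, (hrow _ hnn x).1, levelAxis_eq_two.2 hlt']
    rfl

/-- From a site of axis `2` the tree leads along its column to the next even multiple of `2 ^ k`,
where `k` is the level of the foot of the column. -/
theorem linked_of_axis_two (hh : IsInterlaced h) (hrow : ∀ y, 0 ≤ y → IsLevelRow a h y)
    {n y : ℤ} (hy : 0 ≤ y) (hlt : h (n - y) < h n) :
    ∃ c : ℤ, ((c * 2 ^ h n < y ∧ y < c * 2 ^ h n + 2 ^ h n) ∨
      (y < c * 2 ^ h n ∧ c * 2 ^ h n - 2 ^ h n < y)) ∧ 0 ≤ c ∧ 2 ∣ c ∧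
      h (n - c * 2 ^ h n) = h n ∧
      Linked (latticeTiling f a) (tileAt f a (n - y, y))
        (tileAt f a (n - c * 2 ^ h n, c * 2 ^ h n)) := by
  have hp : (0 : ℤ) < 2 ^ h n := by positivity
  have e1 : ∀ z, (levelAxis (h (n - z)) (h n) = 2 ↔ ¬ (2 : ℤ) ^ h n ∣ z) := by
    intro z
    have := (hh.levelAxis_eq_iff_not_dvd (x := n - z) (y := z)).2
    rwa [sub_add_cancel] at this
  have hnd : ¬ (2 : ℤ) ^ h n ∣ y := by rwa [← e1, levelAxis_eq_two]
  obtain ⟨c, hc2, hc⟩ := exists_multiple hnd 0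
  have hc0 : 0 ≤ c := by
    by_contra! hle
    have : c ≤ -1 := by omega
    have : c * 2 ^ h n ≤ -1 * 2 ^ h n := mul_le_mul_of_nonneg_right this hp.le
    omega
  have heq : h (n - c * 2 ^ h n) = h n := by
    refine hh.eq_of_dvd ?_
    rw [sub_sub_cancel_left, dvd_neg, pow_succ, mul_comm c, mul_dvd_mul_iff_left hp.ne']
    omega
  have hnn : 0 ≤ c * 2 ^ h n := by positivity
  have hsite : ∀ z : ℤ, ((n, 0) : ℤ × ℤ) + z • step 2 = (n - z, z) := by
    intro z; simp [step, sub_eq_add_neg]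
  refine ⟨c, hc, hc0, by simpa using hc2, heq, ?_⟩
  have := linked_of_between f (a := a) (s := (n, 0)) 2 hc (fun z hz hz' => ?_) ?_
  · rwa [hsite, hsite] at this
  · have hz0 : 0 ≤ z := (le_min hnn hy).trans hz
    rw [hsite, (hrow z hz0 _).1, sub_add_cancel, (e1 z).2 hz']
    rfl
  · rw [hsite, (hrow _ hnn _).1, sub_add_cancel, levelAxis_eq_zero.2 heq]
    rfl

/-- From a site of axis `0` outside of the line, the tree leads along its row to a site of axis
`1`. -/
theorem linked_of_axis_zero (hh : IsInterlaced h) (hrow : ∀ y, 0 ≤ y → IsLevelRow a h y)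
    {x y : ℤ} (hy : 0 < y) (heq : h x = h (x + y)) :
    ∃ x', h (x' + y) < h x' ∧ h x < h (x' + y) ∧
      Linked (latticeTiling f a) (tileAt f a (x, y)) (tileAt f a (x', y)) := by
  obtain ⟨j, hj, hj'⟩ : ∃ j : ℕ, (2 : ℤ) ^ j ∣ y ∧ ¬ (2 : ℤ) ^ (j + 1) ∣ y := by
    have hfin : FiniteMultiplicity (2 : ℤ) y :=
      Int.finiteMultiplicity_iff.2 ⟨by decide, by omega⟩
    exact ⟨multiplicity 2 y, pow_multiplicity_dvd _ _,
      hfin.not_pow_dvd_of_multiplicity_lt (Nat.lt_succ_self _)⟩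
  have hax : ∀ z, axis (a (z, y)) = if h z < j then 0 else if h z = j then 2 else 1 := by
    intro z
    rw [(hrow y hy.le z).1, hh.levelAxis_eq hj hj']
  have hxj : h x < j := by
    by_contra! hle
    exact hj' ((pow_dvd_pow 2 (by omega)).trans (hh.eq_iff.1 heq))
  obtain ⟨w, hw⟩ := hh.exists_eq (j + 1)
  have hlow : ∀ z, ¬ (2 : ℤ) ^ j ∣ z → h (w + z) < j := by
    intro z hz
    by_contra! hle
    have := hh.dvd_of_le j (x := w) (y := w + z) (by omega) hle
    rw [add_sub_cancel_left] at this
    exact hz this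
  have hnd : ¬ (2 : ℤ) ^ j ∣ x - w := by
    intro hd
    have := hh.eq_iff' (x := w) (y := x - w)
    rw [add_sub_cancel] at this
    have := this.2 ((pow_dvd_pow 2 hxj).trans hd)
    omega
  have hp : (0 : ℤ) < 2 ^ j := by positivity
  obtain ⟨c, hc2, hc⟩ := exists_multiple hnd 0
  have hwc : j < h (w + c * 2 ^ j) := by
    obtain ⟨e, he⟩ : (2 : ℤ) ∣ c := by omega
    have hd : (2 : ℤ) ^ (j + 1) ∣ c * 2 ^ j := ⟨e, by rw [he, pow_succ]; ring⟩
    by_contra! hle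
    have := hh.eq_iff' (x := w) (y := c * 2 ^ j) |>.2 ((pow_dvd_pow 2 (by omega)).trans hd)
    omega
  have hlev : h (w + c * 2 ^ j + y) = j := by
    have h1 : ¬ h (w + c * 2 ^ j) ≤ h (w + c * 2 ^ j + y) := by
      rw [hh.le_iff]
      exact fun e => hj' ((pow_dvd_pow 2 hwc).trans e)
    have h2 := hh.le_iff'.1 (not_le.1 h1).le
    have h3 := mt hh.eq_iff'.2 (not_le.1 h1).ne'
    apply le_antisymm
    · by_contra! hlt
      exact hj' ((pow_dvd_pow 2 hlt).trans h2)
    · by_contra! hlt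
      exact h3 ((pow_dvd_pow 2 hlt).trans hj)
  refine ⟨w + c * 2 ^ j, by omega, by omega, ?_⟩
  have hsite : ∀ z : ℤ, ((w, y) : ℤ × ℤ) + z • step 0 = (w + z, y) := by
    intro z; simp [step]
  have := linked_of_between f (a := a) (s := (w, y)) 0 hc (fun z hz hz' => ?_) ?_
  · rwa [hsite, hsite, add_sub_cancel] at this
  · rw [hsite, hax, if_pos (hlow z hz')]
    rfl
  · rw [hsite, hax, if_neg (by omega), if_neg (by omega)]
    rfl

/-- A multiple of `2 ^ j` next to `y ≤ 2 ^ K` does not exceed `2 ^ K`, as this is a multiple too. -/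
theorem multiple_le {j K : ℕ} {y c : ℤ} (hjK : j ≤ K) (hy : y ≤ 2 ^ K)
    (hc : c * 2 ^ j - 2 ^ j < y) : c * 2 ^ j ≤ 2 ^ K := by
  obtain ⟨i, rfl⟩ := Nat.exists_eq_add_of_le hjK
  have hp : (0 : ℤ) < 2 ^ j := by positivity
  rw [pow_add] at hy ⊢
  have h1 : (c - 1) * 2 ^ j < 2 ^ i * 2 ^ j := by linarith
  have h2 := lt_of_mul_lt_mul_right h1 hp.le
  rw [mul_comm (2 ^ j)]
  exact mul_le_mul_of_nonneg_right (by omega) hp.le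

/-- The tree of every tile above the line leads to the line: the smaller level of the two
feet increases along the way, while the height remains bounded by `2 ^ K`. The counter `m` bounds the
number of further increases. -/
theorem linked_to_line (hh : IsInterlaced h) (hrow : ∀ y, 0 ≤ y → IsLevelRow a h y) (K : ℕ) :
    ∀ (m : ℕ) (x y : ℤ), 0 ≤ y → y ≤ 2 ^ K → K < min (h x) (h (x + y)) + m →
      ∃ x', Linked (latticeTiling f a) (tileAt f a (x, y)) (tileAt f a (x', 0)) := by
  intro m
  induction m with
  | zero =>
    intro x y hy hyK hm
    rcases hy.eq_or_lt with rfl | hy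
    · exact ⟨x, .refl⟩
    exfalso
    have hd : (2 : ℤ) ^ min (h x) (h (x + y)) ∣ y := by
      rcases le_total (h x) (h (x + y)) with hle | hle
      · rw [min_eq_left hle]; exact hh.le_iff.1 hle
      · rw [min_eq_right hle]; exact hh.le_iff'.1 hle
    have h1 := Int.le_of_dvd hy hd
    have h2 : (2 : ℤ) ^ K < 2 ^ min (h x) (h (x + y)) := pow_lt_pow_right₀ (by norm_num) (by omega)
    omega
  | succ m ih =>
    intro x y hy hyK hm
    rcases hy.eq_or_lt with rfl | hy
    · exact ⟨x, .refl⟩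
    -- A site of axis `2` below the first corner of its column leads directly to the line.
    have two : ∀ n z : ℤ, 0 < z → h (n - z) < h n → z < 2 ^ h n →
        ∃ x', Linked (latticeTiling f a) (tileAt f a (n - z, z)) (tileAt f a (x', 0)) := by
      intro n z hz hlt hzn
      obtain ⟨c, hc, hc0, hc2, -, hl⟩ := linked_of_axis_two f hh hrow hz.le hlt
      have hp : (0 : ℤ) < 2 ^ h n := by positivity
      have h1 : c < 2 := by
        by_contra! hge
        rcases hc with hc | hc <;> nlinarith
      obtain rfl : c = 0 := by omega
      exact ⟨_, by simpa using hl⟩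
    rcases lt_trichotomy (h x) (h (x + y)) with hlt | heq | hgt
    · obtain ⟨n, rfl⟩ : ∃ n, x = n - y := ⟨x + y, by ring⟩
      rw [sub_add_cancel] at hlt hm
      rcases le_or_gt (h n) K with hK | hK
      · obtain ⟨c, hc, hc0, -, heq, hl⟩ := linked_of_axis_two f hh hrow hy.le hlt
        obtain ⟨x', hx'⟩ := ih (n - c * 2 ^ h n) (c * 2 ^ h n) (by positivity) (by
          rcases hc with hc | hc
          · omega
          · exact multiple_le hK hyK hc.2) (by rw [sub_add_cancel, heq]; omega)
        exact ⟨x', hl.trans hx'⟩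
      · exact two n y hy hlt (hyK.trans_lt (pow_lt_pow_right₀ (by norm_num) hK))
    · obtain ⟨x', h1, h2, hl⟩ := linked_of_axis_zero f hh hrow hy heq
      obtain ⟨x'', hx''⟩ := ih x' y hy.le hyK (by omega)
      exact ⟨x'', hl.trans hx''⟩
    · obtain ⟨c, hc, hc0, hlt, hl⟩ := linked_of_axis_one f hh hrow hy.le hgt
      rcases le_or_gt (h x) K with hK | hK
      · obtain ⟨x', hx'⟩ := ih x (c * 2 ^ h x) (by positivity) (by
          rcases hc with hc | hc
          · omega
          · exact multiple_le hK hyK hc.2) (by omega)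
        exact ⟨x', hl.trans hx'⟩
      · have hp : (0 : ℤ) < 2 ^ h x := by positivity
        have hyx : y < 2 ^ h x := hyK.trans_lt (pow_lt_pow_right₀ (by norm_num) hK)
        have h1 : c < 2 := by
          by_contra! hge
          rcases hc with hc | hc <;> nlinarith
        obtain rfl : c = 1 := by omega
        rw [one_mul] at hl hlt
        obtain ⟨x', hx'⟩ := two (x + 2 ^ h x) (2 ^ h x) hp (by rwa [add_sub_cancel_right])
          (pow_lt_pow_right₀ (by norm_num) hlt)
        rw [add_sub_cancel_right] at hx'
        exact ⟨x', hl.trans hx'⟩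

end reach

/-- Above a line that follows interlaced levels, all trees are connected to the line. -/
theorem exists_linked_row (f : Tile) (hh : IsInterlaced h) (hrow : ∀ y, 0 ≤ y → IsLevelRow a h y)
    {x y : ℤ} (hy : 0 ≤ y) :
    ∃ x', Linked (latticeTiling f a) (tileAt f a (x, y)) (tileAt f a (x', 0)) := by
  obtain ⟨Y, rfl⟩ := Int.eq_ofNat_of_zero_le hy
  refine linked_to_line f hh hrow Y (Y + 1) x Y hy ?_ (by omega)
  exact_mod_cast Nat.lt_two_pow_self.le

/-- The tiling seen from the tile `f` rotated by `π`: levels below the line become levels above. -/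
theorem tileAt_rotate (f : Tile) (a : ℤ × ℤ → Fin 6) (s : ℤ × ℤ) :
    tileAt (siteTile f 0 3) (fun s => a (-s) + 3) s = tileAt f a (-s) := by
  have h : ∀ i : Fin 6, 3 + (i + 3) = i := by decide
  simp only [tileAt, siteTile_siteTile, h]

/-- The levels above and below a line, the latter seen after a rotation by `π`, make the trees
connected: all of them lead to the line, along which the trees are linked. -/
theorem satisfiesR2_of_isLevelRow {f : Tile} (hrow0 : ∀ x, axis (a (x, 0)) = 0) {h₁ h₂ : ℤ → ℕ}
    (hh₁ : IsInterlaced h₁) (hh₂ : IsInterlaced h₂) (hup : ∀ y, 0 ≤ y → IsLevelRow a h₁ y)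
    (hdown : ∀ y, 0 ≤ y → IsLevelRow (fun s => a (-s) + 3) h₂ y) :
    SatisfiesR2 (latticeTiling f a) := by
  have hline : ∀ x y, Linked (latticeTiling f a) (tileAt f a (x, 0)) (tileAt f a (y, 0)) := by
    have aux : ∀ (x : ℤ) (n : ℕ),
        Linked (latticeTiling f a) (tileAt f a (x, 0)) (tileAt f a (x + n, 0)) := by
      intro x n
      have hsite : ∀ i : ℤ, ((x, 0) : ℤ × ℤ) + i • step 0 = (x + i, 0) := by
        intro i; simp [step]
      have := linked_run f (a := a) (s := (x, 0)) 0 n (fun i _ => by rw [hsite, hrow0]; rfl)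
        (Or.inl (by rw [hsite, hrow0]; rfl))
      rwa [hsite] at this
    intro x y
    rcases le_total x y with hxy | hxy
    · have := aux x (y - x).toNat
      rwa [Int.toNat_of_nonneg (by omega), add_sub_cancel] at this
    · have := (aux y (x - y).toNat).symm
      rwa [Int.toNat_of_nonneg (by omega), add_sub_cancel] at this
  have hall : ∀ s, ∃ x, Linked (latticeTiling f a) (tileAt f a s) (tileAt f a (x, 0)) := by
    rintro ⟨x, y⟩
    rcases le_total 0 y with hy | hy
    · exact exists_linked_row f hh₁ hup hy
    · obtain ⟨x', hx'⟩ := exists_linked_row (siteTile f 0 3) hh₂ hdown (x := -x) (y := -y) (by omega)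
      rw [latticeTiling_rotate, tileAt_rotate, tileAt_rotate] at hx'
      exact ⟨-x', by simpa using hx'⟩
  rintro _ ⟨s, rfl⟩ _ ⟨t, rfl⟩
  obtain ⟨x, hx⟩ := hall s
  obtain ⟨y, hy⟩ := hall t
  exact (hx.trans (hline x y)).trans hy.symm

/-! ### The tiling with prescribed levels -/

/-- The tile orientation with axis `l`, and R1-curve leaving it in direction `l` on the
counterclockwise side if `s` is true. -/
def orient : Fin 3 → Bool → Fin 6
  | 0, true => 0
  | 0, false => 3
  | 1, true => 1
  | 1, false => 4
  | 2, true => 2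
  | 2, false => 5

theorem axis_orient (l : Fin 3) (s : Bool) : axis (orient l s) = l := by
  revert l s; decide

theorem osign_orient (s : Bool) :
    osign (0 - orient 0 s) = s ∧ osign (1 - orient 1 s) = s ∧ osign (2 - orient 2 s) = s := by
  revert s; decide

theorem osign_zero_sub {t : Fin 6} :
    (axis t = 1 → osign (0 - t) = false) ∧ (axis t = 2 → osign (0 - t) = true) := by
  revert t; decide

theorem legal_of_bonds
    (h0 : ∀ x y, osign (0 - a (x, y)) ≠ osign (3 - a (x + 1, y)))
    (h1 : ∀ x y, osign (1 - a (x, y)) ≠ osign (4 - a (x, y + 1)))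
    (h2 : ∀ x y, osign (2 - a (x + 1, y)) ≠ osign (5 - a (x, y + 1))) : Legal a := by
  rintro ⟨x, y⟩ d
  fin_cases d
  · simpa [step] using h0 x y
  · simpa [step] using h1 x y
  · simpa [step, ← sub_eq_add_neg] using h2 (x - 1) y
  · simpa [step, ← sub_eq_add_neg] using (h0 (x - 1) y).symm
  · simpa [step, ← sub_eq_add_neg] using (h1 x (y - 1)).symm
  · simpa [step, ← sub_eq_add_neg] using (h2 x (y - 1)).symm

/-- Consecutive rows that follow the same levels satisfy R1 along the bonds between them. -/
theorem IsLevelRow.bonds (hh : IsInterlaced h) {y : ℤ} (hy : IsLevelRow a h y)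
    (hy' : IsLevelRow a h (y + 1)) (x : ℤ) :
    osign (1 - a (x, y)) ≠ osign (4 - a (x, y + 1)) ∧
      osign (2 - a (x + 1, y)) ≠ osign (5 - a (x, y + 1)) := by
  have hA := (hy x).2.1
  have hB := (hy (x + 1)).2.2
  obtain ⟨hax, hA', hB'⟩ := hy' x
  rw [show x + 1 + y = x + (y + 1) by ring] at hB
  have e1 := even_add_one_ediv_iff (k := h x) (y := y)
  have e2 := even_add_one_ediv_iff (k := h (x + (y + 1))) (y := y)
  obtain ⟨f1, f2⟩ := hh.levelAxis_eq_iff_not_dvd (x := x) (y := y + 1)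
  rw [← hax] at f1 f2
  rw [← f1, ← hA, ← hA'] at e1
  rw [← f2, ← not_iff_not (a := Even _) (b := Even _), ← hB, ← hB'] at e2
  have o1 := @osign_opposite_of_axis_eq 1 (a (x, y + 1))
  have o1' := @osign_opposite_of_axis_ne 1 (a (x, y + 1))
  have o2 := @osign_opposite_of_axis_eq 2 (a (x, y + 1))
  have o2' := @osign_opposite_of_axis_ne 2 (a (x, y + 1))
  have d1 : axis 1 = 1 := rfl
  have d2 : axis 2 = 2 := rfl
  have d3 : (1 : Fin 6) + 3 = 4 := rfl
  have d4 : (2 : Fin 6) + 3 = 5 := rfl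
  rw [d1, d3] at o1 o1'
  rw [d2, d4] at o2 o2'
  constructor
  · by_cases c : axis (a (x, y + 1)) = 1
    · rw [o1 c]
      have := e1.2 c
      revert this
      cases osign (1 - a (x, y + 1)) <;> cases osign (1 - a (x, y)) <;> simp
    · rw [o1' c]
      have := mt e1.1 c
      revert this
      cases osign (1 - a (x, y + 1)) <;> cases osign (1 - a (x, y)) <;> simp
  · by_cases c : axis (a (x, y + 1)) = 2
    · rw [o2 c]
      have := e2.2 c
      revert this
      cases osign (2 - a (x, y + 1)) <;> cases osign (2 - a (x + 1, y)) <;> simp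
    · rw [o2' c]
      have := mt e2.1 c
      revert this
      cases osign (2 - a (x, y + 1)) <;> cases osign (2 - a (x + 1, y)) <;> simp

/-- A row in which every site has the axis prescribed by the levels follows the levels if the
straight R1-curves of axis `1` and `2` have the prescribed sides. -/
theorem isLevelRow_of_orient (hh : IsInterlaced h) {y : ℤ} {σ : ℤ → Bool}
    (ha : ∀ x, a (x, y) = orient (levelAxis (h x) (h (x + y)))
      (if h x = h (x + y) then σ x else if h (x + y) < h x then decide (Even (y / 2 ^ h x))
        else !decide (Even (y / 2 ^ h (x + y))))) : IsLevelRow a h y := by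
  intro x
  have hax : axis (a (x, y)) = levelAxis (h x) (h (x + y)) := by rw [ha, axis_orient]
  refine ⟨hax, ?_⟩
  have f1 := hh.eq_iff (x := x) (y := y)
  have f2 := hh.le_iff (x := x) (y := y)
  have f3 := hh.eq_iff' (x := x) (y := y)
  have f4 := hh.le_iff' (x := x) (y := y)
  have g1 := fun hd => even_ediv_iff (k := h x) (y := y) hd
  have g2 := fun hd => even_ediv_iff (k := h (x + y)) (y := y) hd
  have ha := ha x
  rcases lt_trichotomy (h x) (h (x + y)) with hlt | heq | hgt
  · rw [if_neg hlt.ne, if_neg hlt.not_gt, levelAxis_eq_two.2 hlt] at ha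
    rw [levelAxis_eq_two.2 hlt] at hax
    rw [(axis_signs_two hax).1, g1 (f2.1 hlt.le), ha, (osign_orient _).2.2]
    simpa using mt f1.2 hlt.ne
  · rw [levelAxis_eq_zero.2 heq] at hax
    obtain ⟨s1, -, s3, -⟩ := axis_signs_zero hax
    rw [s1, s3, g1 (f2.1 heq.le), g2 (f4.1 heq.ge)]
    simp [f1.1 heq, f3.1 heq]
  · rw [if_neg hgt.ne', if_pos hgt, levelAxis_eq_one.2 hgt] at ha
    rw [levelAxis_eq_one.2 hgt] at hax
    rw [(axis_signs_one hax).2.1, g2 (f4.1 hgt.le), ha, (osign_orient _).2.1]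
    simpa using mt f3.2 hgt.ne'

/-- The R1-curve of axis `0` in a row of height `y ≠ 0` changes side at the sites of axis `1` and
`2`, which alternate. -/
theorem row_bonds (hh : IsInterlaced h) {y c : ℤ} {j : ℕ} (hj : (2 : ℤ) ^ j ∣ y)
    (hj' : ¬ (2 : ℤ) ^ (j + 1) ∣ y) (hc : h c = j)
    (hax : ∀ x, axis (a (x, y)) = levelAxis (h x) (h (x + y)))
    (ha : ∀ x, h x = h (x + y) → a (x, y) = orient 0 (decide (Even ((x - c) / 2 ^ j)))) (x : ℤ) :
    osign (0 - a (x, y)) ≠ osign (3 - a (x + 1, y)) := by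
  have hp : (0 : ℤ) < 2 ^ j := by positivity
  have hlev : ∀ z, axis (a (z, y)) = if h z < j then 0 else if h z = j then 2 else 1 := by
    intro z; rw [hax, hh.levelAxis_eq hj hj']
  have hge : ∀ z, j ≤ h z ↔ (2 : ℤ) ^ j ∣ z - c := by
    intro z
    have := hh.le_iff (x := c) (y := z - c)
    rwa [hc, add_sub_cancel] at this
  have hout : ∀ z, osign (0 - a (z, y)) = decide (Even ((z - c) / 2 ^ j)) := by
    intro z
    have hz := hlev z
    split_ifs at hz with h1 h2
    · rw [hax, levelAxis_eq_zero] at hz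
      rw [ha z hz, (osign_orient _).1]
    · rw [osign_zero_sub.2 hz, eq_comm, decide_eq_true_eq, even_ediv_iff ((hge z).1 h2.ge)]
      have := hh.dvd_of_eq (x := c) (y := z) (by omega)
      rwa [hc] at this
    · rw [osign_zero_sub.1 hz, eq_comm, decide_eq_false_iff_not,
        even_ediv_iff ((hge z).1 (by omega))]
      intro hd
      have := hh.eq_of_dvd (x := c) (y := z) (by rwa [hc])
      omega
  have e1 := even_add_one_ediv_iff (k := j) (y := x - c)
  rw [show x - c + 1 = x + 1 - c by ring, ← hge] at e1
  have o1 := @osign_opposite_of_axis_eq 0 (a (x + 1, y))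
  have o1' := @osign_opposite_of_axis_ne 0 (a (x + 1, y))
  have d1 : axis 0 = 0 := rfl
  have d3 : (0 : Fin 6) + 3 = 3 := rfl
  rw [d1, d3, hout] at o1 o1'
  rw [hout]
  have hx := hlev (x + 1)
  by_cases c : h (x + 1) < j
  · rw [if_pos c] at hx
    rw [o1 hx]
    simp [e1.2 (by omega)]
  · rw [if_neg c] at hx
    have hne : axis (a (x + 1, y)) ≠ 0 := by
      rw [hx]; split_ifs <;> decide
    rw [o1' hne]
    have := mt e1.1 (by omega)
    rw [Ne, decide_eq_decide]
    tauto

/-- Interlaced levels can be prescribed above and below the line independently: the row `y = 0`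
follows any levels, so the two half-planes fit together. -/
theorem exists_legal_of_levels {h₁ h₂ : ℤ → ℕ} (hh₁ : IsInterlaced h₁) (hh₂ : IsInterlaced h₂) :
    ∃ a, Legal a ∧ (∀ x, a (x, 0) = 0) ∧ (∀ y, 0 ≤ y → IsLevelRow a h₁ y) ∧
      ∀ y ≤ 0, IsLevelRow a h₂ y := by
  let H : ℤ → ℤ → ℕ := fun y => if 0 ≤ y then h₁ else h₂
  have hH : ∀ y, IsInterlaced (H y) := by
    intro y; simp only [H]; split_ifs <;> assumption
  have hjc : ∀ y : ℤ, ∃ (j : ℕ) (c : ℤ), H y c = j ∧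
      (y ≠ 0 → (2 : ℤ) ^ j ∣ y ∧ ¬ (2 : ℤ) ^ (j + 1) ∣ y) := by
    intro y
    by_cases hy : y = 0
    · exact ⟨_, 0, rfl, fun h => absurd hy h⟩
    · have hfin : FiniteMultiplicity (2 : ℤ) y :=
        Int.finiteMultiplicity_iff.2 ⟨by decide, hy⟩
      obtain ⟨c, hc⟩ := (hH y).exists_eq (multiplicity 2 y)
      exact ⟨_, c, hc, fun _ => ⟨pow_multiplicity_dvd _ _,
        hfin.not_pow_dvd_of_multiplicity_lt (Nat.lt_succ_self _)⟩⟩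
  choose j c hc hj using hjc
  let σ : ℤ → ℤ → Bool := fun y x => decide (y = 0) || decide (Even ((x - c y) / 2 ^ j y))
  let a : ℤ × ℤ → Fin 6 := fun s =>
    orient (levelAxis (H s.2 s.1) (H s.2 (s.1 + s.2)))
      (if H s.2 s.1 = H s.2 (s.1 + s.2) then σ s.2 s.1
        else if H s.2 (s.1 + s.2) < H s.2 s.1 then decide (Even (s.2 / 2 ^ H s.2 s.1))
        else !decide (Even (s.2 / 2 ^ H s.2 (s.1 + s.2))))
  have hrow : ∀ y, IsLevelRow a (H y) y := fun y =>
    isLevelRow_of_orient (hH y) (σ := σ y) fun x => rfl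
  have h0 : ∀ x, a (x, 0) = 0 := by
    intro x
    simp [a, σ, levelAxis, orient]
  have hup : ∀ y, 0 ≤ y → IsLevelRow a h₁ y := by
    intro y hy
    have := hrow y
    simpa only [H, if_pos hy] using this
  have hdown : ∀ y ≤ 0, IsLevelRow a h₂ y := by
    intro y hy
    rcases hy.eq_or_lt with rfl | hy
    · intro x
      obtain ⟨s1, -, s3, -⟩ := axis_signs_zero (t := a (x, 0)) (by rw [h0]; rfl)
      rw [s1, s3, h0]
      simp [levelAxis, axis]
    · have := hrow y
      simpa only [H, if_neg (not_le.2 hy)] using this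
  have hbonds : ∀ x y, osign (1 - a (x, y)) ≠ osign (4 - a (x, y + 1)) ∧
      osign (2 - a (x + 1, y)) ≠ osign (5 - a (x, y + 1)) := by
    intro x y
    rcases le_or_gt 0 y with hy | hy
    · exact (hup y hy).bonds hh₁ (hup (y + 1) (by omega)) x
    · exact (hdown y hy.le).bonds hh₂ (hdown (y + 1) (by omega)) x
  refine ⟨a, legal_of_bonds (fun x y => ?_) (fun x y => (hbonds x y).1) (fun x y => (hbonds x y).2),
    h0, hup, hdown⟩
  by_cases hy : y = 0
  · subst hy
    rw [h0, h0]; decide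
  · obtain ⟨hj1, hj2⟩ := hj y hy
    refine row_bonds (hH y) hj1 hj2 (hc y) (fun x => (hrow y x).1) (fun x hx => ?_) x
    simp only [a, σ, hx, hy, levelAxis, if_true, decide_false, Bool.false_or]

/-! ### Consequences for the tilings with a bi-infinite line -/

/-- As the trees are connected, no column above the line is straight to infinity, so the half-plane
follows interlaced levels. -/
theorem exists_levels {f : Tile} (ha : Legal a) (hR : SatisfiesR2 (latticeTiling f a))
    (hrow : ∀ x, axis (a (x, 0)) = 0) :
    ∃ h : ℤ → ℕ, IsInterlaced h ∧ ∀ y, 0 ≤ y → IsLevelRow a h y := by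
  refine exists_isLevelRow ha hrow fun x hx => ?_
  refine not_infinite_ray ha hR hrow (s := (x, 0)) (d := 1) (by rw [hrow]; rfl) fun t ht => ?_
  rw [show ((x, 0) : ℤ × ℤ) + (t : ℤ) • step 1 = (x, (t : ℤ)) by simp [step], hx t (by omega)]
  rfl

theorem exists_levels_below {f : Tile} (ha : Legal a) (hR : SatisfiesR2 (latticeTiling f a))
    (hrow : ∀ x, axis (a (x, 0)) = 0) :
    ∃ h : ℤ → ℕ, IsInterlaced h ∧ ∀ y, 0 ≤ y → IsLevelRow (fun s => a (-s) + 3) h y := by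
  refine exists_levels (f := siteTile f 0 3) ha.rotate (by rwa [latticeTiling_rotate]) fun x => ?_
  rw [axis_add_three, Prod.neg_mk, neg_zero, hrow]

theorem not_isInfiniteR1Triangle {f : Tile} (ha : Legal a) (hR : SatisfiesR2 (latticeTiling f a))
    (hrow : ∀ x, axis (a (x, 0)) = 0) (τ : ℤ → Tile × Fin 6) :
    ¬ IsInfiniteR1Triangle (latticeTiling f a) τ := by
  -- The two rays of an infinite triangle leave the tile of its corner across the edges `1` and `2`,
  -- or `4` and `5`; only one of them is cut off from the tree of this tile.
  have aux : ∀ τ : ℤ → Tile × Fin 6, IsInfiniteR1Triangle (latticeTiling f a) τ →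
      ¬ (mate (τ 0).2 = 1 ∨ mate (τ 0).2 = 4) := by
    rintro τ ⟨hw, hst⟩ hm
    obtain ⟨s, hs⟩ := (hw 0).1
    have hstraight : ∀ n : ℕ, 0 < n → IsStraight (τ n).2 := fun n hn => by
      by_contra hns
      have := (hst n).1 hns
      omega
    refine not_infinite_ray ha hR hrow (s := s) (d := a s + mate (τ 0).2) ?_ fun t ht => ?_
    · revert hm
      generalize a s = q
      generalize mate (τ 0).2 = e
      revert q e; decide
    · have h1 := hw.ray (s := s) (i := (τ 0).2) (Prod.ext hs.symm rfl) rfl (N := t)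
        (fun n hn _ => hstraight n hn) t ht le_rfl
      have h2 := hstraight t ht
      rwa [h1, isStraight_iff_axis] at h2
  intro hτ
  have h1 := aux τ hτ
  have h2 := aux (fun n => ((τ (-n)).1, mate (τ (-n)).2))
    ⟨hτ.1.reverse, fun n => by
      rw [isStraight_mate_iff, hτ.2]; omega⟩
  have h3 := (hτ.2 0).2 rfl
  simp only [neg_zero, mate_mate] at h2
  revert h1 h2 h3
  generalize (τ 0).2 = e
  revert e; decide

/-- A translation that preserves the tiling preserves the line, as every other row contains sites
of non-zero axis; and it is then a period of the levels. -/
theorem nonperiodic_latticeTiling {f : Tile} (hh : IsInterlaced h)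
    (hrow : ∀ y, 0 ≤ y → IsLevelRow a h y) : Nonperiodic (latticeTiling f a) := by
  intro v hv
  have hax0 : ∀ x, axis (a (x, 0)) = 0 := fun x => by
    rw [(hrow 0 le_rfl x).1, add_zero, levelAxis_eq_zero]
  have htr : ∀ s, ∃ t, f.center + f.rot * siteVec s + v = f.center + f.rot * siteVec t ∧
      a t = a s := by
    intro s
    have h1 : Tile.translate v (siteTile f s (a s)) ∈ latticeTiling f a := by
      rw [← hv]; exact ⟨_, ⟨s, rfl⟩, rfl⟩
    obtain ⟨t, ht⟩ := h1
    refine ⟨t, (congrArg Tile.center ht).symm, ?_⟩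
    have h2 : siteTile f 0 (a t) = siteTile f 0 (a s) := Tile.ext (congrArg Tile.rot ht :) rfl
    exact (siteTile_injective h2).2
  obtain ⟨w, hw, -⟩ := htr 0
  have hvw : v = f.rot * siteVec w := by
    simp only [siteVec, Prod.fst_zero, Prod.snd_zero] at hw ⊢
    push_cast at hw
    linear_combination hw
  have hper : ∀ s, a (s + w) = a s := by
    intro s
    obtain ⟨t, ht, hat⟩ := htr s
    have h1 : (f.rot : ℂ) * siteVec (s + w) = f.rot * siteVec t := by
      rw [siteVec_add, mul_add, ← hvw]
      linear_combination ht
    rw [siteVec_injective (mul_left_cancel₀ f.rot.coe_ne_zero h1), hat]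
  have hne : ∀ y : ℤ, 0 < y → ¬ ∀ x, axis (a (x, y)) = 0 := by
    intro y hy hall
    obtain ⟨x, hx⟩ := hh.exists_eq y.toNat
    have h1 := hall x
    rw [(hrow y hy.le x).1, levelAxis_eq_zero, hh.eq_iff] at h1
    have h2 := Int.le_of_dvd hy h1
    have h3 : y.toNat < 2 ^ y.toNat := Nat.lt_two_pow_self
    have h4 : ((y.toNat : ℕ) : ℤ) < ((2 ^ y.toNat : ℕ) : ℤ) := by exact_mod_cast h3
    rw [hx, pow_succ] at h2
    push_cast at h4
    omega
  obtain ⟨x₀, y₀⟩ := w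
  have hy₀ : y₀ = 0 := by
    rcases lt_trichotomy y₀ 0 with hlt | heq | hgt
    · refine absurd (fun x => ?_) (hne (-y₀) (by omega))
      have := hper (x, -y₀)
      rw [Prod.mk_add_mk, neg_add_cancel] at this
      rw [← this, hax0]
    · exact heq
    · refine absurd (fun x => ?_) (hne y₀ hgt)
      have := hper (x - x₀, 0)
      rw [Prod.mk_add_mk, zero_add, sub_add_cancel] at this
      rw [this, hax0]
  subst hy₀
  have hx₀ : x₀ = 0 := by
    refine hh.eq_zero_of_periodic fun n => hh.level_eq_of_column_eq hh fun t ht _ _ => ?_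
    have := hper (n, t)
    rw [Prod.mk_add_mk, add_zero] at this
    rw [← (hrow t ht.le _).1, ← (hrow t ht.le _).1, this]
  subst hx₀
  rw [hvw]
  simp [siteVec]

/-- The levels of the half-planes are those of the triangles along the line. Below the line, positions
are reflected, since the half-plane is seen after a rotation by `π`. -/
theorem hasLevels_of_isLevelRow {p : Tile} (ha : Legal a) (hrow0 : ∀ x, a (x, 0) = 0)
    {h₁ h₂ : ℤ → ℕ} (hh₁ : IsInterlaced h₁) (hh₂ : IsInterlaced h₂)
    (hup : ∀ y, 0 ≤ y → IsLevelRow a h₁ y)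
    (hdown : ∀ y, 0 ≤ y → IsLevelRow (fun s => a (-s) + 3) h₂ y) {γ : ℤ → Tile × Fin 6}
    (hγ : ∀ n : ℤ, γ n = (siteTile p (n, 0) 0, 3)) :
    HasLevels (latticeTiling p a) γ 1 h₁ ∧
      HasLevels (latticeTiling p a) γ 4 fun n => h₂ (-n) := by
  constructor
  · intro n
    have := isCornerOfTriangle_of_isLevelRow (f := p) ha hh₁ hup n
    rw [hrow0] at this
    rw [hγ]
    exact this
  · intro n
    have := isCornerOfTriangle_of_isLevelRow (f := siteTile p 0 3) ha.rotate hh₂ hdown (-n)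
    have h1 := tileAt_rotate p a (-n, 0)
    simp only [tileAt] at h1
    rw [h1, latticeTiling_rotate] at this
    simp only [Prod.neg_mk, neg_zero, neg_neg, hrow0] at this
    rw [hγ]
    exact this

theorem levels_unique {p : Tile} (hrow0 : ∀ x, a (x, 0) = 0)
    {h₁ h₂ g₁ g₂ : ℤ → ℕ} (hh₁ : IsInterlaced h₁) (hh₂ : IsInterlaced h₂)
    (hup : ∀ y, 0 ≤ y → IsLevelRow a h₁ y)
    (hdown : ∀ y, 0 ≤ y → IsLevelRow (fun s => a (-s) + 3) h₂ y) {γ : ℤ → Tile × Fin 6}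
    (hγ : ∀ n : ℤ, γ n = (siteTile p (n, 0) 0, 3))
    (h1 : HasLevels (latticeTiling p a) γ 1 g₁) (h4 : HasLevels (latticeTiling p a) γ 4 g₂) :
    h₁ = g₁ ∧ h₂ = fun n => g₂ (-n) := by
  constructor
  · funext n
    have := h1 n
    rw [hγ] at this
    exact (eq_of_isCornerOfTriangle (f := p) hh₁ hup (by rw [hrow0]; exact this)).symm
  · funext n
    have := h4 (-n)
    rw [hγ] at this
    refine (eq_of_isCornerOfTriangle (f := siteTile p 0 3) hh₂ hdown ?_).symm
    have h1 := tileAt_rotate p a (n, 0)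
    simp only [tileAt] at h1
    rw [h1, latticeTiling_rotate]
    simp only [Prod.neg_mk, neg_zero, hrow0]
    exact this

theorem eq_of_axis_eq_of_osign_eq {t u : Fin 6} (h : axis t = axis u)
    (h1 : osign (1 - t) = osign (1 - u)) (h2 : osign (2 - t) = osign (2 - u))
    (h3 : axis t ≠ 0 ∨ osign (3 - t) = osign (3 - u)) : t = u := by
  revert t u; decide

/-- The levels determine the half-plane above the line: the sides of the R1-curves of axis `0` are
propagated along the rows from the sites of non-zero axis. -/
theorem eq_of_isLevelRow {b : ℤ × ℤ → Fin 6} (ha : Legal a) (hb : Legal b) (hh : IsInterlaced h)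
    {y : ℤ} (hy : 0 < y) (hay : IsLevelRow a h y) (hby : IsLevelRow b h y) (x : ℤ) :
    a (x, y) = b (x, y) := by
  have hax : ∀ x, axis (a (x, y)) = axis (b (x, y)) := fun x => by rw [(hay x).1, (hby x).1]
  have h1 : ∀ x, osign (1 - a (x, y)) = osign (1 - b (x, y)) := fun x =>
    Bool.eq_iff_iff.2 ((hay x).2.1.trans (hby x).2.1.symm)
  have h2 : ∀ x, osign (2 - a (x, y)) = osign (2 - b (x, y)) := fun x =>
    Bool.eq_iff_iff.2 ((hay x).2.2.trans (hby x).2.2.symm)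
  have hstep : ∀ x, a (x, y) = b (x, y) → a (x + 1, y) = b (x + 1, y) := by
    intro x hx
    refine eq_of_axis_eq_of_osign_eq (hax _) (h1 _) (h2 _) (Or.inr ?_)
    have e1 := ha.right x y
    have e2 := hb.right x y
    rw [hx] at e1
    revert e1 e2
    cases osign (0 - b (x, y)) <;> cases osign (3 - a (x + 1, y)) <;>
      cases osign (3 - b (x + 1, y)) <;> simp
  obtain ⟨c, hc⟩ := hh.exists_eq y.toNat
  have hstart : ∀ k : ℤ, a (c + k * 2 ^ (y.toNat + 1), y) = b (c + k * 2 ^ (y.toNat + 1), y) := by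
    intro k
    refine eq_of_axis_eq_of_osign_eq (hax _) (h1 _) (h2 _) (Or.inl ?_)
    have hlev : h (c + k * 2 ^ (y.toNat + 1)) = y.toNat := by
      rw [← hc]
      exact hh.eq_of_dvd (by rw [add_sub_cancel_left]; exact dvd_mul_left _ _)
    rw [(hay _).1, Ne, levelAxis_eq_zero, hh.eq_iff, hlev]
    intro hd
    have h2 := Int.le_of_dvd hy hd
    have h3 : y.toNat < 2 ^ y.toNat := Nat.lt_two_pow_self
    have h4 : ((y.toNat : ℕ) : ℤ) < ((2 ^ y.toNat : ℕ) : ℤ) := by exact_mod_cast h3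
    rw [pow_succ] at h2
    push_cast at h4
    omega
  obtain ⟨k, hk⟩ : ∃ k : ℤ, c + k * 2 ^ (y.toNat + 1) ≤ x := by
    refine ⟨-|x - c|, ?_⟩
    have h3 : (1 : ℤ) ≤ 2 ^ (y.toNat + 1) := one_le_pow₀ (by norm_num)
    have h4 := neg_abs_le (x - c)
    nlinarith [abs_nonneg (x - c)]
  induction x, hk using Int.leInduction with
  | base => exact hstart k
  | succ x _ ih => exact hstep x ih

theorem legal_unique {b : ℤ × ℤ → Fin 6} (ha : Legal a) (hb : Legal b) {h₁ h₂ : ℤ → ℕ}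
    (ha0 : ∀ x, a (x, 0) = 0) (hb0 : ∀ x, b (x, 0) = 0)
    (hh₁ : IsInterlaced h₁) (hh₂ : IsInterlaced h₂)
    (haup : ∀ y, 0 ≤ y → IsLevelRow a h₁ y)
    (hadown : ∀ y, 0 ≤ y → IsLevelRow (fun s => a (-s) + 3) h₂ y)
    (hbup : ∀ y, 0 ≤ y → IsLevelRow b h₁ y)
    (hbdown : ∀ y, 0 ≤ y → IsLevelRow (fun s => b (-s) + 3) h₂ y) : a = b := by
  funext ⟨x, y⟩
  rcases lt_trichotomy y 0 with hy | rfl | hy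
  · have := eq_of_isLevelRow ha.rotate hb.rotate hh₂ (y := -y) (by omega)
      (hadown _ (by omega)) (hbdown _ (by omega)) (-x)
    simpa using this
  · rw [ha0, hb0]
  · exact eq_of_isLevelRow ha hb hh₁ hy (haup y hy.le) (hbup y hy.le) x

/-- Seen after a rotation by `π`, a row that follows the levels `h` follows the reflected levels. The
row below it is needed to know the sides on which the R1-curves enter. -/
theorem IsLevelRow.rotate {y : ℤ} (hy : IsLevelRow a h y)
    (hy' : IsLevelRow a h (y - 1)) (ha : Legal a) :
    IsLevelRow (fun s => a (-s) + 3) (fun n => h (-n)) (-y) := by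
  intro x
  obtain ⟨h1, h2, h3⟩ := hy (-x)
  have e1 := ha.up (-x) (y - 1)
  have e2 := ha.upLeft (-x) (y - 1)
  rw [sub_add_cancel] at e1 e2
  have g1 := (hy' (-x)).2.1
  have g2 := (hy' (-x + 1)).2.2
  rw [show -x + 1 + (y - 1) = -x + y by ring] at g2
  simp only [Prod.neg_mk, neg_neg, axis_add_three, neg_add_rev]
  rw [show y + -x = -x + y by ring]
  have s1 : ∀ t : Fin 6, 1 - (t + 3) = 4 - t := by decide
  have s2 : ∀ t : Fin 6, 2 - (t + 3) = 5 - t := by decide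
  rw [s1, s2]
  have d : ∀ k : ℕ, (Even (-y / 2 ^ k) ↔ ¬ Even ((y - 1) / 2 ^ k)) := by
    intro k
    have hp : (0 : ℤ) < 2 ^ k := by positivity
    have : -y / 2 ^ k = -((y - 1) / 2 ^ k + 1) := by
      have a1 := Int.emod_add_mul_ediv (y - 1) (2 ^ k)
      have a2 := Int.emod_nonneg (y - 1) hp.ne'
      have a3 := Int.emod_lt_of_pos (y - 1) hp
      refine Int.ediv_eq_iff_of_pos hp |>.2 ⟨?_, ?_⟩ <;> linarith
    rw [this, even_neg, Int.even_add_one]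
  refine ⟨h1, ?_, ?_⟩
  · rw [d, ← g1]
    revert e1
    cases osign (1 - a (-x, y - 1)) <;> cases osign (4 - a (-x, y)) <;> simp
  · rw [d, not_not]
    rw [← not_iff_not, ← g2]
    revert e2
    cases osign (2 - a (-x + 1, y - 1)) <;> cases osign (5 - a (-x, y)) <;> simp

/-- There is a tiling with prescribed levels on both sides of a line through a given tile. -/
theorem exists_tiling (p : Tile) {h₁ h₂ : ℤ → ℕ} (hh₁ : IsInterlaced h₁) (hh₂ : IsInterlaced h₂) :
    ∃ T ∈ classC1, ∃ γ, IsR1Line T γ ∧ γ 0 = (p, 3) ∧ HasLevels T γ 1 h₁ ∧ HasLevels T γ 4 h₂ := by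
  obtain ⟨a, ha, ha0, hup, hdown⟩ := exists_legal_of_levels hh₁ hh₂
  have hdown' : ∀ y, 0 ≤ y → IsLevelRow (fun s => a (-s) + 3) (fun n => h₂ (-n)) y := by
    intro y hy
    have := (hdown (-y) (by omega)).rotate (hdown (-y - 1) (by omega)) ha
    rwa [neg_neg] at this
  have hline := isR1Line_row (f := p) ha0
  obtain ⟨h1, h4⟩ := hasLevels_of_isLevelRow (p := p) ha ha0 hh₁ hh₂.comp_neg hup hdown'
    (γ := fun n : ℤ => (siteTile p (n, 0) 0, 3)) fun _ => rfl
  refine ⟨latticeTiling p a, ⟨⟨isTiling_latticeTiling p a, satisfiesR1_latticeTiling_iff.2 ha,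
    satisfiesR2_of_isLevelRow (fun x => by rw [ha0]; rfl) hh₁ hh₂.comp_neg hup hdown'⟩, _, hline⟩,
    _, hline, ?_, h1, by simpa only [neg_neg] using h4⟩
  exact Prod.ext (siteTile_zero p) rfl

/-- A line can be traversed so that it enters its tile at position `0` through edge `3`. -/
theorem IsR1Line.normalize {T : Set Tile} {γ : ℤ → Tile × Fin 6} (hγ : IsR1Line T γ) :
    γ 0 = ((γ 0).1, 3) ∨ ((γ (-0)).1, mate (γ (-0)).2) = ((γ 0).1, 3) := by
  rcases hγ.2 0 with h | h
  · right; rw [neg_zero, h]; rfl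
  · left; rw [← h]

/-- A tiling with a bi-infinite line, presented from a tile of the line. -/
theorem exists_latticeTiling_of_mem_classC1 {T : Set Tile} (hT : T ∈ classC1) :
    ∃ p a, T = latticeTiling p a ∧ Legal a ∧ SatisfiesR2 (latticeTiling p a) ∧
      ∀ x, axis (a (x, 0)) = 0 := by
  obtain ⟨hC, γ, hγ⟩ := hT
  obtain ⟨γ', hγ', h0⟩ : ∃ γ', IsR1Line T γ' ∧ γ' 0 = ((γ 0).1, 3) := by
    rcases hγ.normalize with h | h
    · exact ⟨γ, hγ, h⟩
    · exact ⟨_, hγ.reverse, h⟩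
  obtain ⟨a, rfl, ha, ha0, -⟩ := exists_latticeTiling_of_line hC hγ' h0
  exact ⟨_, a, rfl, ha, hC.2.2, fun x => by rw [ha0]; rfl⟩

theorem exists_hasLevels_of_line {T : Set Tile} (hT : T ∈ classC) {γ : ℤ → Tile × Fin 6}
    (hγ : IsR1Line T γ) :
    ∃ h₁ h₂ : ℤ → ℕ, IsInterlaced h₁ ∧ IsInterlaced h₂ ∧
      HasLevels T γ 1 h₁ ∧ HasLevels T γ 4 h₂ := by
  have key : ∀ γ : ℤ → Tile × Fin 6, IsR1Line T γ → ∀ p, γ 0 = (p, 3) →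
      ∃ h₁ h₂ : ℤ → ℕ, IsInterlaced h₁ ∧ IsInterlaced h₂ ∧
        HasLevels T γ 1 h₁ ∧ HasLevels T γ 4 h₂ := by
    intro γ hγ p h0
    obtain ⟨a, rfl, ha, ha0, hγa⟩ := exists_latticeTiling_of_line hT hγ h0
    have hrow : ∀ x, axis (a (x, 0)) = 0 := fun x => by rw [ha0]; rfl
    obtain ⟨h₁, hh₁, hup⟩ := exists_levels ha hT.2.2 hrow
    obtain ⟨h₂, hh₂, hdown⟩ := exists_levels_below ha hT.2.2 hrow
    exact ⟨h₁, _, hh₁, hh₂.comp_neg, hasLevels_of_isLevelRow ha ha0 hh₁ hh₂ hup hdown hγa⟩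
  rcases hγ.normalize with h | h
  · exact key γ hγ _ h
  · obtain ⟨h₁, h₂, hh₁, hh₂, l1, l4⟩ := key _ hγ.reverse _ h
    refine ⟨_, _, hh₁.comp_neg, hh₂.comp_neg, fun n => ?_, fun n => ?_⟩
    · simpa using l1 (-n)
    · simpa using l4 (-n)

theorem tiling_unique {p : Tile} {h₁ h₂ : ℤ → ℕ} {T T' : Set Tile} (hT : T ∈ classC)
    (hT' : T' ∈ classC)
    (hl : ∃ γ, IsR1Line T γ ∧ γ 0 = (p, 3) ∧ HasLevels T γ 1 h₁ ∧ HasLevels T γ 4 h₂)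
    (hl' : ∃ γ, IsR1Line T' γ ∧ γ 0 = (p, 3) ∧ HasLevels T' γ 1 h₁ ∧ HasLevels T' γ 4 h₂) :
    T = T' := by
  have key : ∀ T ∈ classC,
      (∃ γ, IsR1Line T γ ∧ γ 0 = (p, 3) ∧ HasLevels T γ 1 h₁ ∧ HasLevels T γ 4 h₂) →
      ∃ a, T = latticeTiling p a ∧ Legal a ∧ (∀ x, a (x, 0) = 0) ∧
        IsInterlaced h₁ ∧ IsInterlaced (fun n => h₂ (-n)) ∧ (∀ y, 0 ≤ y → IsLevelRow a h₁ y) ∧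
        ∀ y, 0 ≤ y → IsLevelRow (fun s => a (-s) + 3) (fun n => h₂ (-n)) y := by
    rintro T hT ⟨γ, hγ, h0, l1, l4⟩
    obtain ⟨a, rfl, ha, ha0, hγa⟩ := exists_latticeTiling_of_line hT hγ h0
    have hrow : ∀ x, axis (a (x, 0)) = 0 := fun x => by rw [ha0]; rfl
    obtain ⟨g₁, hg₁, hup⟩ := exists_levels ha hT.2.2 hrow
    obtain ⟨g₂, hg₂, hdown⟩ := exists_levels_below ha hT.2.2 hrow
    obtain ⟨rfl, rfl⟩ := levels_unique ha0 hg₁ hg₂ hup hdown hγa l1 l4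
    exact ⟨a, rfl, ha, ha0, hg₁, hg₂, hup, hdown⟩
  obtain ⟨a, rfl, ha, ha0, hh₁, hh₂, hup, hdown⟩ := key T hT hl
  obtain ⟨b, rfl, hb, hb0, -, -, hup', hdown'⟩ := key T' hT' hl'
  rw [legal_unique ha hb ha0 hb0 hh₁ hh₂ hup hdown hup' hdown']

end DendriteMonotile

open DendriteMonotile
theorem mainTheorem3 :
    classC1.Nonempty ∧
    (∀ T ∈ classC1, Nonperiodic T) ∧
    (∀ T ∈ classC1, ¬ ∃ γ, IsInfiniteR1Triangle T γ) ∧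
    (∀ T ∈ classC1, ∀ γ, IsR1Line T γ →
      ∃ h₁ h₂ : ℤ → ℕ, IsInterlaced h₁ ∧ IsInterlaced h₂ ∧
        HasLevels T γ 1 h₁ ∧ HasLevels T γ 4 h₂) ∧
    (∀ p : Tile, ∀ h₁ h₂ : ℤ → ℕ, IsInterlaced h₁ → IsInterlaced h₂ →
      ∃! T : Set Tile, T ∈ classC1 ∧
        ∃ γ, IsR1Line T γ ∧ γ 0 = (p, 3) ∧ HasLevels T γ 1 h₁ ∧ HasLevels T γ 4 h₂) := by
  refine ⟨?_, fun T hT => ?_, fun T hT => ?_, fun T hT γ hγ => exists_hasLevels_of_line hT.1 hγ,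
    fun p h₁ h₂ hh₁ hh₂ => ?_⟩
  · obtain ⟨h, hh⟩ := exists_isInterlaced
    obtain ⟨T, hT, -⟩ := exists_tiling ⟨1, 0⟩ hh hh
    exact ⟨T, hT⟩
  · obtain ⟨p, a, rfl, ha, hR, hrow⟩ := exists_latticeTiling_of_mem_classC1 hT
    obtain ⟨h, hh, hup⟩ := exists_levels ha hR hrow
    exact nonperiodic_latticeTiling hh hup
  · obtain ⟨p, a, rfl, ha, hR, hrow⟩ := exists_latticeTiling_of_mem_classC1 hT
    rintro ⟨τ, hτ⟩
    exact not_isInfiniteR1Triangle ha hR hrow τ hτ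
  · obtain ⟨T, hT, hl⟩ := exists_tiling p hh₁ hh₂
    exact ⟨T, ⟨hT, hl⟩, fun T' hT' => tiling_unique hT'.1.1 hT.1 hT'.2 hl⟩
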